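/- Let $A$ be a symmetrizable generalized Cartan matrix, $(\mathfrak h,\Pi,\Pi^\vee)$ a realization of $A$ over $\mathbb C$, and $\mathfrak g=\mathfrak g(A)$ the associated Kac--Moody algebra (with generators $\mathfrak h\cup\{e_i,f_i\}$ and the Chevalley--Serre relations). Let $\Delta$ be its set of roots and $Q^+$ the set of nonnegative integral combinations of simple roots; let $P\subset\mathfrak h^*$ be a restricted weight lattice, i.e. a subgroup containing the simple roots, taking integral values on the simple coroots, and having a $\mathbb Z$-basis that is a $\mathbb C$-basis of $\mathfrak h^*$ and extends a set of fundamental weights. Let $V$ be a standard graded $\mathfrak g$-module: $V$ is the direct sum of finite-dimensional weight spaces $V_\mu$ with weights $\mu\in P$, and there is given a $\mathbb Z$-linear map $f:P\to\mathbb Z$ such that for all $m\in\mathbb Z$ the sets $\Delta_m=\{\alpha\in\Delta\cup\{0\}: f(\alpha)=m\}$ and $\mathrm{wts}_m(V)=\{\mu \text{ a weight of } V: f(\mu)=m\}$ are finite, $\Delta_m$ consists of positive roots if $m>0$, of negative roots if $m<0$, and $\Delta_0=\{0\}$, and distinct elements of $\mathrm{wts}_m(V)$ are incomparable in the order given by $\mu\le\nu\iff\nu-\mu\in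 Q^+$. Put $\mathfrak g_m=\bigoplus_{\alpha\in\Delta_m}\mathfrak g_\alpha$, $V_m=\bigoplus_{\mu\in\mathrm{wts}_m(V)}V_\mu$, $\widehat V=\bigoplus_{m<0}V_m\oplus\prod_{m\ge0}V_m$, and $\widehat N_j=\prod_{m\ge j}V_m\subseteq\widehat V$ for $j\in\mathbb Z$. For $k\ge1$ let $$\widehat U^+_{V,k}=\Bigl\{\cdots\exp(\rho(x_{k+2}))\exp(\rho(x_{k+1}))\exp(\rho(x_k)) \;:\; x_i\in\mathfrak g_i \text{ for } i\ge k\Bigr\}\subseteq \mathrm{GL}(\widehat V),$$ where $\rho$ is the action of $\mathfrak g$, extended to $\widehat V$; in each degree, the exponential series applied to a vector are finite sums and the partial products applied to a vector are eventually constant. Call a group pro-unipotent if it is the projective limit of a directed system of quotients which are (finite-dimensional) unipotent algebraic groups over $\mathbb C$, with morphisms of algebraic groups as transition maps. **Theorem.** The $\widehat U^+_{V,k}$ $(k\ge1)$ form a descending chain of subgroups of $\mathrm{GL}(\widehat V)$, normal in $\widehat U^+_{V,1}$, and $\widehat U^+_{V,1}$ is a pro-unipotent group: the quotients $\widehat U^+_{V,1}/\widehat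 U^+_{V,k}$ are unipotent algebraic groups, the canonical maps between them are morphisms of algebraic groups, and the canonical homomorphism $$\widehat U^+_{V,1}\longrightarrow\varprojlim_{k\ge1}\widehat U^+_{V,1}/\widehat U^+_{V,k}$$ is an isomorphism. Moreover $\widehat U^+_{V,1}$ maps each $\widehat N_j$ $(j\in\mathbb Z)$ onto itself and acts on each $\widehat V/\widehat N_j$ by locally unipotent operators; and, for every $k\ge1$, the action of $\widehat U^+_{V,1}$ on the product $\prod_{j\in\mathbb Z}\widehat N_j/\widehat N_{j+k}$ factors through a faithful action of $\widehat U^+_{V,1}/\widehat U^+_{V,k}$, in which every element $q$ is unipotent, with $(q-1)^k=0$. -/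

import Mathlib

set_option maxSynthPendingDepth 3

noncomputable section

namespace KacMoody

/-! ### Generalized Cartan matrices and realizations -/

/-- `A` is a generalized Cartan matrix. -/
structure IsGCM {l : ℕ} (A : Matrix (Fin l) (Fin l) ℤ) : Prop where
  diag : ∀ i, A i i = 2
  offDiag : ∀ i j, i ≠ j → A i j ≤ 0
  zeros : ∀ i j, A i j = 0 → A j i = 0

/-- `A` is symmetrizable: `diag(d) A` is symmetric for some positive rational numbers `d i`. -/
def IsSymmetrizable {l : ℕ} (A : Matrix (Fin l) (Fin l) ℤ) : Prop :=
  ∃ d : Fin l → ℚ, (∀ i, 0 < d i) ∧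
    (Matrix.diagonal d * A.map (Int.cast : ℤ → ℚ)).IsSymm

/-- A realization `(𝔥, Π, Π^∨)` of `A`. -/
structure Realization {l : ℕ} (A : Matrix (Fin l) (Fin l) ℤ)
    (𝔥 : Type*) [AddCommGroup 𝔥] [Module ℂ 𝔥] where
  finiteDimensional : FiniteDimensional ℂ 𝔥
  /-- `dim 𝔥 = 2l - rank A`. -/
  finrank_add_rank : Module.finrank ℂ 𝔥 + (A.map (Int.cast : ℤ → ℂ)).rank = 2 * l
  /-- the simple roots -/
  root : Fin l → Module.Dual ℂ 𝔥
  /-- the simple coroots -/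
  coroot : Fin l → 𝔥
  root_linearIndependent : LinearIndependent ℂ root
  coroot_linearIndependent : LinearIndependent ℂ coroot
  pairing : ∀ i j, root j (coroot i) = (A i j : ℂ)

/-! ### The Kac--Moody algebra by generators and relations -/

/-- The generating set `𝔥 ∪ {e i, f i}`. -/
inductive Gen (l : ℕ) (𝔥 : Type*)
  | h : 𝔥 → Gen l 𝔥
  | e : Fin l → Gen l 𝔥
  | f : Fin l → Gen l 𝔥

section Algebra

variable {l : ℕ} {A : Matrix (Fin l) (Fin l) ℤ} {𝔥 : Type*} [AddCommGroup 𝔥] [Module ℂ 𝔥]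

/-- The free Lie algebra on the generating set. -/
abbrev FreeAlg (l : ℕ) (𝔥 : Type*) := FreeLieAlgebra ℂ (Gen l 𝔥)

/-- The generator `h` in the free Lie algebra. -/
def gh (l : ℕ) (x : 𝔥) : FreeAlg l 𝔥 := FreeLieAlgebra.of ℂ (Gen.h x)

/-- The generator `e i` in the free Lie algebra. -/
def ge (𝔥 : Type*) (i : Fin l) : FreeAlg l 𝔥 := FreeLieAlgebra.of ℂ (Gen.e i)

/-- The generator `f i` in the free Lie algebra. -/
def gf (𝔥 : Type*) (i : Fin l) : FreeAlg l 𝔥 := FreeLieAlgebra.of ℂ (Gen.f i)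

/-- The defining relators of the Kac--Moody algebra; the first two say that the vector space
structure of `𝔥` is kept. -/
inductive Realization.Relator (R : Realization A 𝔥) : FreeAlg l 𝔥 → Prop
  | h_add (x y : 𝔥) : R.Relator (gh l (x + y) - (gh l x + gh l y))
  | h_smul (c : ℂ) (x : 𝔥) : R.Relator (gh l (c • x) - c • gh l x)
  | h_h (x y : 𝔥) : R.Relator ⁅gh l x, gh l y⁆
  | h_e (x : 𝔥) (i : Fin l) : R.Relator (⁅gh l x, ge 𝔥 i⁆ - R.root i x • ge 𝔥 i)
  | h_f (x : 𝔥) (i : Fin l) : R.Relator (⁅gh l x, gf 𝔥 i⁆ + R.root i x • gf 𝔥 i)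
  | e_f_same (i : Fin l) : R.Relator (⁅ge 𝔥 i, gf 𝔥 i⁆ - gh l (R.coroot i))
  | e_f_ne (i j : Fin l) : i ≠ j → R.Relator ⁅ge 𝔥 i, gf 𝔥 j⁆
  | ad_e (i j : Fin l) : i ≠ j →
      R.Relator (((LieAlgebra.ad ℂ (FreeAlg l 𝔥) (ge 𝔥 i)) ^ (1 - A i j).toNat) (ge 𝔥 j))
  | ad_f (i j : Fin l) : i ≠ j →
      R.Relator (((LieAlgebra.ad ℂ (FreeAlg l 𝔥) (gf 𝔥 i)) ^ (1 - A i j).toNat) (gf 𝔥 j))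

/-- The ideal generated by the defining relators. -/
def Realization.relIdeal (R : Realization A 𝔥) : LieIdeal ℂ (FreeAlg l 𝔥) :=
  LieSubmodule.lieSpan ℂ (FreeAlg l 𝔥) {x | R.Relator x}

/-- The Kac--Moody algebra `𝔤 = 𝔤(A)`. -/
def Realization.LieAlg (R : Realization A 𝔥) := FreeAlg l 𝔥 ⧸ R.relIdeal

instance (R : Realization A 𝔥) : LieRing R.LieAlg :=
  inferInstanceAs (LieRing (FreeAlg l 𝔥 ⧸ R.relIdeal))

instance (R : Realization A 𝔥) : LieAlgebra ℂ R.LieAlg :=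
  inferInstanceAs (LieAlgebra ℂ (FreeAlg l 𝔥 ⧸ R.relIdeal))

/-- The image of `h ∈ 𝔥` in `𝔤`. -/
def Realization.H (R : Realization A 𝔥) (x : 𝔥) : R.LieAlg :=
  LieSubmodule.Quotient.mk (N := R.relIdeal) (gh l x)

/-! ### Roots, weights and weight modules -/

/-- The weight space `V_μ`. -/
def Realization.weightSpace (R : Realization A 𝔥) (V : Type*) [AddCommGroup V] [Module ℂ V]
    [LieRingModule R.LieAlg V] [LieModule ℂ R.LieAlg V] (μ : Module.Dual ℂ 𝔥) :
    Submodule ℂ V where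
  carrier := {v | ∀ x : 𝔥, ⁅R.H x, v⁆ = μ x • v}
  add_mem' := by
    intro a b ha hb x
    rw [lie_add, ha x, hb x, smul_add]
  zero_mem' := by
    intro x
    simp
  smul_mem' := by
    intro c v hv x
    rw [lie_smul, hv x, smul_comm]

/-- `μ` is a weight of `V`. -/
def Realization.IsWeight (R : Realization A 𝔥) (V : Type*) [AddCommGroup V] [Module ℂ V]
    [LieRingModule R.LieAlg V] [LieModule ℂ R.LieAlg V] (μ : Module.Dual ℂ 𝔥) : Prop :=
  R.weightSpace V μ ≠ ⊥

/-- The root space `𝔤_α`, the weight space of the adjoint module. -/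
abbrev Realization.rootSpace (R : Realization A 𝔥) (α : Module.Dual ℂ 𝔥) :
    Submodule ℂ R.LieAlg := R.weightSpace R.LieAlg α

/-- `α` is a root. -/
def Realization.IsRoot (R : Realization A 𝔥) (α : Module.Dual ℂ 𝔥) : Prop :=
  α ≠ 0 ∧ R.rootSpace α ≠ ⊥

/-- `Q⁺`, the nonnegative integral combinations of simple roots. -/
def Realization.QPlus (R : Realization A 𝔥) : AddSubmonoid (Module.Dual ℂ 𝔥) :=
  AddSubmonoid.closure (Set.range R.root)

/-- `α` is a positive root. -/
def Realization.IsPosRoot (R : Realization A 𝔥) (α : Module.Dual ℂ 𝔥) : Prop :=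
  R.IsRoot α ∧ α ∈ R.QPlus

/-- `α` is a negative root. -/
def Realization.IsNegRoot (R : Realization A 𝔥) (α : Module.Dual ℂ 𝔥) : Prop :=
  R.IsRoot α ∧ -α ∈ R.QPlus

/-- The dominance order `μ ≤ ν`. -/
def Realization.DomLE (R : Realization A 𝔥) (μ ν : Module.Dual ℂ 𝔥) : Prop :=
  ν - μ ∈ R.QPlus

/-- `P` is a restricted weight lattice. -/
structure Realization.IsRestrictedWeightLattice (R : Realization A 𝔥)
    (P : AddSubgroup (Module.Dual ℂ 𝔥)) : Prop where
  root_mem : ∀ i, R.root i ∈ P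
  integral : ∀ μ ∈ P, ∀ i, ∃ z : ℤ, μ (R.coroot i) = z
  /-- `P` contains a minimal regular weight (this follows from the next condition). -/
  regular : ∃ ρ ∈ P, ∀ i, ρ (R.coroot i) = 1
  /-- `P` has a `ℤ`-basis which is a `ℂ`-basis of the dual of `𝔥` and extends a set of
  fundamental weights. -/
  restricted : ∃ (m : ℕ) (b : Module.Basis (Fin l ⊕ Fin m) ℂ (Module.Dual ℂ 𝔥)),
    (∀ i j, b (Sum.inl i) (R.coroot j) = if i = j then 1 else 0) ∧
    P = AddSubgroup.closure (Set.range b)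

/-- `V` is a weight module: it is the direct sum of its weight spaces, which are all finite
dimensional. -/
structure Realization.IsWeightModule (R : Realization A 𝔥) (V : Type*) [AddCommGroup V]
    [Module ℂ V] [LieRingModule R.LieAlg V] [LieModule ℂ R.LieAlg V] : Prop where
  independent : iSupIndep (R.weightSpace V)
  span : ⨆ μ, R.weightSpace V μ = ⊤
  finite : ∀ μ, FiniteDimensional ℂ (R.weightSpace V μ)

/-! ### Standard graded modules -/

/-- `Δ_m`, the set of `α ∈ Δ ∪ {0}` with `f α = m`. -/
def Realization.rootsDeg (R : Realization A 𝔥) {P : AddSubgroup (Module.Dual ℂ 𝔥)}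
    (f : P →+ ℤ) (m : ℤ) : Set (Module.Dual ℂ 𝔥) :=
  {α | (R.IsRoot α ∨ α = 0) ∧ ∃ h : α ∈ P, f ⟨α, h⟩ = m}

/-- `wts_m(V)`, the set of weights `μ` of `V` with `f μ = m`. -/
def Realization.wtsDeg (R : Realization A 𝔥) (V : Type*) [AddCommGroup V] [Module ℂ V]
    [LieRingModule R.LieAlg V] [LieModule ℂ R.LieAlg V] {P : AddSubgroup (Module.Dual ℂ 𝔥)}
    (f : P →+ ℤ) (m : ℤ) : Set (Module.Dual ℂ 𝔥) :=
  {μ | R.IsWeight V μ ∧ ∃ h : μ ∈ P, f ⟨μ, h⟩ = m}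

/-- `V` is a standard graded module with grading function `f : P → ℤ`: a weight module with
weights in `P` such that the additive map `f` satisfies the following conditions. -/
structure Realization.IsStandardGraded (R : Realization A 𝔥) (V : Type*) [AddCommGroup V]
    [Module ℂ V] [LieRingModule R.LieAlg V] [LieModule ℂ R.LieAlg V]
    {P : AddSubgroup (Module.Dual ℂ 𝔥)} (f : P →+ ℤ) : Prop where
  weightModule : R.IsWeightModule V
  weight_mem : ∀ μ, R.IsWeight V μ → μ ∈ P
  finite_roots : ∀ m, (R.rootsDeg f m).Finite
  finite_wts : ∀ m, (R.wtsDeg V f m).Finite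
  roots_pos : ∀ m, 0 < m → ∀ α ∈ R.rootsDeg f m, R.IsPosRoot α
  roots_zero : R.rootsDeg f 0 = {0}
  roots_neg : ∀ m, m < 0 → ∀ α ∈ R.rootsDeg f m, R.IsNegRoot α
  incomparable : ∀ m, ∀ μ ∈ R.wtsDeg V f m, ∀ ν ∈ R.wtsDeg V f m, R.DomLE μ ν → μ = ν

/-- `𝔤_m`, the sum of the `𝔤_α` with `α ∈ Δ_m`. -/
def Realization.gPart (R : Realization A 𝔥) {P : AddSubgroup (Module.Dual ℂ 𝔥)}
    (f : P →+ ℤ) (m : ℤ) : Submodule ℂ R.LieAlg :=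
  ⨆ α : R.rootsDeg f m, R.rootSpace α

section Module

variable (R : Realization A 𝔥) (V : Type*) [AddCommGroup V] [Module ℂ V]
  [LieRingModule R.LieAlg V] [LieModule ℂ R.LieAlg V]
  {P : AddSubgroup (Module.Dual ℂ 𝔥)} (f : P →+ ℤ)

/-- `V_m`, the sum of the `V_μ` with `μ ∈ wts_m(V)`. -/
def Realization.vPart (m : ℤ) : Submodule ℂ V :=
  ⨆ μ : R.wtsDeg V f m, R.weightSpace V μ

variable {V}

theorem Realization.lie_mem_weightSpace {α μ : Module.Dual ℂ 𝔥} {x : R.LieAlg} {v : V}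
    (hx : x ∈ R.rootSpace α) (hv : v ∈ R.weightSpace V μ) :
    ⁅x, v⁆ ∈ R.weightSpace V (α + μ) := by
  intro h
  rw [leibniz_lie, hx h, hv h, smul_lie, lie_smul, LinearMap.add_apply, add_smul]

theorem Realization.lie_mem_vPart {k m : ℤ} {x : R.LieAlg} {v : V}
    (hx : x ∈ R.gPart f k) (hv : v ∈ R.vPart V f m) : ⁅x, v⁆ ∈ R.vPart V f (k + m) := by
  refine Submodule.iSup_induction _ (motive := fun x => ⁅x, v⁆ ∈ R.vPart V f (k + m)) hx
    ?_ (by simp) (fun a b ha hb => by rw [add_lie]; exact add_mem ha hb)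
  rintro ⟨α, _, hαP, hα⟩ y hy
  refine Submodule.iSup_induction _ (motive := fun v => ⁅y, v⁆ ∈ R.vPart V f (k + m)) hv
    ?_ (by simp) (fun a b ha hb => by rw [lie_add]; exact add_mem ha hb)
  rintro ⟨μ, _, hμP, hμ⟩ w hw
  have hmem := R.lie_mem_weightSpace hy hw
  by_cases h0 : R.weightSpace V (α + μ) = ⊥
  · rw [h0, Submodule.mem_bot] at hmem
    rw [hmem]
    exact zero_mem _
  · refine Submodule.mem_iSup_of_mem
      (p := fun ν : R.wtsDeg V f (k + m) => R.weightSpace V ν.1)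
      ⟨α + μ, h0, add_mem hαP hμP, ?_⟩ hmem
    rw [← hα, ← hμ, ← map_add]
    rfl

variable (V)

/-! ### The completion -/

/-- The completion of `V`: the elements of the product of the `V_m` that vanish in all
sufficiently negative degrees. -/
def Realization.completion : Submodule ℂ (ℤ → V) where
  carrier := {v | (∀ m, v m ∈ R.vPart V f m) ∧ ∃ N : ℤ, ∀ m < N, v m = 0}
  add_mem' := by
    rintro a b ⟨ha, N, hN⟩ ⟨hb, M, hM⟩
    refine ⟨fun m => add_mem (ha m) (hb m), min N M, fun m hm => ?_⟩
    rw [Pi.add_apply, hN m (lt_of_lt_of_le hm (min_le_left _ _)),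
      hM m (lt_of_lt_of_le hm (min_le_right _ _)), add_zero]
  zero_mem' := ⟨fun m => zero_mem _, 0, fun m _ => rfl⟩
  smul_mem' := by
    rintro c a ⟨ha, N, hN⟩
    refine ⟨fun m => Submodule.smul_mem _ c (ha m), N, fun m hm => ?_⟩
    rw [Pi.smul_apply, hN m hm, smul_zero]

/-- The submodule of the completion of elements supported in degrees `≥ k`. -/
def Realization.nHat (k : ℤ) : Submodule ℂ (R.completion V f) where
  carrier := {v | ∀ m < k, v.1 m = 0}
  add_mem' := by
    intro a b ha hb m hm
    change a.1 m + b.1 m = 0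
    rw [ha m hm, hb m hm, add_zero]
  zero_mem' := fun m _ => rfl
  smul_mem' := by
    intro c a ha m hm
    change c • a.1 m = 0
    rw [ha m hm, smul_zero]

/-- The action of `x ∈ 𝔤_k` on the completion. -/
def Realization.rhoHat {k : ℤ} (x : R.gPart f k) : Module.End ℂ (R.completion V f) where
  toFun v := ⟨fun m => ⁅x.1, v.1 (m - k)⁆, by
    obtain ⟨hv, N, hN⟩ := v.2
    refine ⟨fun m => ?_, N + k, fun m hm => ?_⟩
    · have h := R.lie_mem_vPart f x.2 (hv (m - k))
      rwa [add_sub_cancel] at h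
    · change ⁅x.1, v.1 (m - k)⁆ = 0
      rw [hN (m - k) (by omega), lie_zero]⟩
  map_add' := by
    intro a b
    apply Subtype.ext
    funext m
    exact lie_add _ _ _
  map_smul' := by
    intro c a
    apply Subtype.ext
    funext m
    exact lie_smul _ _ _

theorem Realization.rhoHat_pow_eq_zero {k : ℤ} (x : R.gPart f k) (v : R.completion V f)
    {N : ℤ} (hN : ∀ m < N, v.1 m = 0) (n : ℕ) :
    ∀ m < N + n * k, ((R.rhoHat V f x ^ n) v).1 m = 0 := by
  induction n with
  | zero => intro m hm; exact hN m (by simpa using hm)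
  | succ n ih =>
    intro m hm
    rw [pow_succ']
    change ⁅x.1, ((R.rhoHat V f x ^ n) v).1 (m - k)⁆ = 0
    rw [ih (m - k) (by push_cast at hm; linarith), lie_zero]

theorem Realization.expSeries_finite (k : ℕ+) (x : R.gPart f (k : ℤ)) (v : R.completion V f)
    (m : ℤ) : (Function.support fun n : ℕ =>
      ((n.factorial : ℂ)⁻¹ • ((R.rhoHat V f x ^ n) v).1 m)).Finite := by
  obtain ⟨-, N, hN⟩ := v.2
  refine (Set.finite_lt_nat ((m - N).toNat + 1)).subset fun n hn => ?_
  by_contra hlt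
  refine hn ?_
  have hlt' : (m - N).toNat + 1 ≤ n := not_lt.mp hlt
  have h1 : m < N + n := by omega
  have hk : (1 : ℤ) ≤ (k : ℤ) := by exact_mod_cast k.2
  have h2 : (n : ℤ) ≤ n * (k : ℤ) := le_mul_of_one_le_right (by positivity) hk
  change (n.factorial : ℂ)⁻¹ • ((R.rhoHat V f x ^ n) v).1 m = 0
  rw [R.rhoHat_pow_eq_zero V f x v hN n m (by linarith), smul_zero]

/-- `exp(ρ(x)) = ∑ₙ ρ(x)ⁿ / n!` on the completion, for `x ∈ 𝔤_k` with `k ≥ 1`; in each degree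
the sum has finitely many nonzero terms. -/
def Realization.expRho (k : ℕ+) (x : R.gPart f (k : ℤ)) :
    Module.End ℂ (R.completion V f) where
  toFun v := ⟨fun m => ∑ᶠ n : ℕ, (n.factorial : ℂ)⁻¹ • ((R.rhoHat V f x ^ n) v).1 m, by
    obtain ⟨-, N, hN⟩ := v.2
    refine ⟨fun m => ?_, N, fun m hm => ?_⟩
    · exact finsum_induction (· ∈ R.vPart V f m) (zero_mem _) (fun _ _ => add_mem)
        fun n => Submodule.smul_mem _ _ (((R.rhoHat V f x ^ n) v).2.1 m)
    · refine finsum_eq_zero_of_forall_eq_zero fun n => ?_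
      have h2 : (0 : ℤ) ≤ n * ((k : ℕ) : ℤ) := by positivity
      rw [R.rhoHat_pow_eq_zero V f x v hN n m (by linarith), smul_zero]⟩
  map_add' := by
    intro a b
    apply Subtype.ext
    funext m
    change (∑ᶠ n : ℕ, (n.factorial : ℂ)⁻¹ • ((R.rhoHat V f x ^ n) (a + b)).1 m) =
      (∑ᶠ n : ℕ, (n.factorial : ℂ)⁻¹ • ((R.rhoHat V f x ^ n) a).1 m) +
      (∑ᶠ n : ℕ, (n.factorial : ℂ)⁻¹ • ((R.rhoHat V f x ^ n) b).1 m)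
    rw [← finsum_add_distrib (R.expSeries_finite V f k x a m) (R.expSeries_finite V f k x b m)]
    refine finsum_congr fun n => ?_
    rw [map_add, ← smul_add]
    rfl
  map_smul' := by
    intro c a
    apply Subtype.ext
    funext m
    change (∑ᶠ n : ℕ, (n.factorial : ℂ)⁻¹ • ((R.rhoHat V f x ^ n) (c • a)).1 m) =
      c • ∑ᶠ n : ℕ, (n.factorial : ℂ)⁻¹ • ((R.rhoHat V f x ^ n) a).1 m
    rw [smul_finsum]
    refine finsum_congr fun n => ?_
    rw [map_smul, smul_comm c]
    rfl

/-- The partial product `exp(ρ(x_{n+K-1})) ⋯ exp(ρ(x_{n+1})) exp(ρ(x_n))`. -/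
def Realization.partialProd (x : ∀ k : ℕ+, R.gPart f (k : ℤ)) (n : ℕ+) :
    ℕ → Module.End ℂ (R.completion V f)
  | 0 => 1
  | K + 1 => R.expRho V f ⟨n + K, Nat.add_pos_left n.2 K⟩ (x _) * Realization.partialProd x n K

/-- The set `Û⁺_{V,n}` of all infinite products `∏_{k ≥ n} exp(ρ(x_k))`, `x_k ∈ 𝔤_k`, as a set of
linear automorphisms of the completion. Each component of the sequence of partial products is
eventually constant, and the infinite product is the limit. -/
def Realization.uHat (n : ℕ+) : Set (LinearMap.GeneralLinearGroup ℂ (R.completion V f)) :=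
  {φ | ∃ x : ∀ k : ℕ+, R.gPart f (k : ℤ), ∀ (v : R.completion V f) (m : ℤ),
    ∀ᶠ K in Filter.atTop,
      (R.partialProd V f x n K v).1 m = (φ.1 v).1 m}

end Module

end Algebra

/-! ### Pro-unipotent groups -/

/-- A (finite dimensional) unipotent algebraic group over `ℂ`: a Zariski closed subgroup of
`GL_n(ℂ)` consisting of unipotent matrices. -/
structure UnipotentAlgebraicGroup where
  /-- the size of the matrices -/
  n : ℕ
  /-- the group of matrices -/
  group : Subgroup (Matrix.GeneralLinearGroup (Fin n) ℂ)
  closed : ∃ S : Set (MvPolynomial (Fin n × Fin n) ℂ),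
    ∀ g : Matrix.GeneralLinearGroup (Fin n) ℂ,
      g ∈ group ↔ ∀ p ∈ S, MvPolynomial.eval (fun ij => g.1 ij.1 ij.2) p = 0
  unipotent : ∀ g ∈ group, IsNilpotent (g.1 - 1)

/-- A homomorphism of unipotent algebraic groups is a morphism of algebraic groups: its matrix
entries are polynomials in the matrix entries (all determinants are `1`). -/
def IsRegularHom {H H' : UnipotentAlgebraicGroup} (φ : H.group →* H'.group) : Prop :=
  ∃ p : Fin H'.n → Fin H'.n → MvPolynomial (Fin H.n × Fin H.n) ℂ,
    ∀ (g : H.group) (i j : Fin H'.n),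
      (φ g).1.1 i j = MvPolynomial.eval (fun ab => g.1.1 ab.1 ab.2) (p i j)

section Pro

variable {G : Type*} [Group G] {ι : Type*} [Preorder ι] (N : ι → Subgroup G)
  [∀ i, (N i).Normal] (hN : Antitone N)

/-- The canonical map `G/N_j → G/N_i` for `i ≤ j`. -/
def transition {i j : ι} (hij : i ≤ j) : G ⧸ N j →* G ⧸ N i :=
  QuotientGroup.map (N j) (N i) (MonoidHom.id G) (hN hij)

/-- The inverse limit of the quotients `G/N_i`. -/
def inverseLimit : Subgroup (∀ i, G ⧸ N i) where
  carrier := {y | ∀ (i j : ι) (hij : i ≤ j), transition N hN hij (y j) = y i}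
  mul_mem' := by
    intro a b ha hb i j hij
    rw [Pi.mul_apply, map_mul, ha i j hij, hb i j hij, Pi.mul_apply]
  one_mem' := by
    intro i j hij
    exact map_one _
  inv_mem' := by
    intro a ha i j hij
    rw [Pi.inv_apply, map_inv, ha i j hij, Pi.inv_apply]

/-- The canonical homomorphism from `G` to the inverse limit of the quotients `G/N_i`. -/
def toInverseLimit : G →* inverseLimit N hN where
  toFun g := ⟨fun i => (g : G ⧸ N i), fun _ _ _ => rfl⟩
  map_one' := rfl
  map_mul' _ _ := rfl

/-- The quotients `G/N_i` are unipotent algebraic groups and the canonical maps between them are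
morphisms of algebraic groups. -/
def IsUnipotentSystem : Prop :=
  ∃ (H : ι → UnipotentAlgebraicGroup) (e : ∀ i, G ⧸ N i ≃* (H i).group),
    ∀ (i j : ι) (hij : i ≤ j),
      IsRegularHom (((e i).toMonoidHom.comp (transition N hN hij)).comp (e j).symm.toMonoidHom)

end Pro

/-- A group is pro-unipotent if it is the projective limit of quotients that are
unipotent algebraic groups, with morphisms of algebraic groups as transition maps. -/
def IsProUnipotent (G : Type*) [Group G] : Prop :=
  ∃ (ι : Type) (_ : Preorder ι) (_ : Nonempty ι) (_ : IsDirected ι (· ≤ ·))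
    (N : ι → Subgroup G) (_ : ∀ i, (N i).Normal) (hN : Antitone N),
    IsUnipotentSystem N hN ∧ Function.Bijective (toInverseLimit N hN)

end KacMoody

end

noncomputable section

namespace KacMoody

open PowerSeries Finset

/-! ### Power series vanishing to a given order -/

section Order

variable {R : Type*} [Ring R]

/-! An operator on the completion that is a sum of components raising degree by `d = 0, 1, 2, …` is
encoded as a power series over `Module.End ℂ V`; the variable `X` only records the degree. Let `L d`
be the space of operators on `V` coming from `𝔤_d` for `d ≥ 1` (`opPart`). The exponential of an
element of `𝔤_k` becomes `exp (a X ^ k)` with `a ∈ L k`, and congruence to `1` modulo `X ^ k` gives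
the filtration.

That the infinite products form a group is shown without the Baker–Campbell–Hausdorff formula. Let
`expGroup` be the set of series `g` with constant coefficient `1` whose logarithmic derivative `(X
g') g⁻¹` has its `d`-th coefficient in `L d` for every `d`. The logarithmic derivative is a cocycle
(`logDer_mul`), so closure under products and inverses reduces to stability of these Lie series
under conjugation. This follows from the equation `X w' = [logDer g, w]` for `w = g a g⁻¹`
(`conj_C_mem`, `conj_mem_lieSeries`, `conj_inv_mem_lieSeries`). The condition is closed in the
`X`-adic topology, so infinite products of exponentials lie in the group (`exists_expProd`).
Conversely the leading coefficient of an element congruent to `1` modulo `X ^ k` lies in `L k`, so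
exponentials can be split off one degree at a time (`exists_expPartialProd_eq`). Closedness also
gives completeness (`bijective_toInverseLimit`).

For the quotient modulo `X ^ k`, the group acts by truncated left multiplication on a
finite-dimensional space of truncated series with coefficients in the associative algebra generated
by `L`. The image is Zariski closed (`mem_range_truncMatrix`): the logarithmic derivative is
polynomial in the coefficients of `g`, its lying in `L` is a linear condition, and every truncated
solution lifts because the defining differential equation can be solved
(`exists_mem_expGroup_coeff_eq`).

Finite dimension of `L d` comes from the finiteness of `Δ_d` and of the root spaces of positive
roots, which are spanned by iterated brackets of the `e i` of fixed length (`finite_rootSpace`).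
Finally, series act faithfully on the completion because the `V_m` span `V`, and the image of the
filtration is the given family of product sets (`coe_uGroup`). The statements on the `N̂_j` say that
`γ - 1` raises degree by at least `k` exactly when its series is divisible by `X ^ k`. -/

/-- The power series all of whose coefficients in degrees `< k` vanish. -/
def vanishBelow (R : Type*) [Ring R] (k : ℕ) : AddSubgroup R⟦X⟧ where
  carrier := {a | ∀ d < k, coeff d a = 0}
  add_mem' ha hb d hd := by rw [map_add, ha d hd, hb d hd, add_zero]
  zero_mem' d _ := map_zero _
  neg_mem' ha d hd := by rw [map_neg, ha d hd, neg_zero]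

theorem mem_vanishBelow {k : ℕ} {a : R⟦X⟧} : a ∈ vanishBelow R k ↔ ∀ d < k, coeff d a = 0 :=
  Iff.rfl

theorem mul_mem_vanishBelow {j k : ℕ} {a b : R⟦X⟧} (ha : a ∈ vanishBelow R j)
    (hb : b ∈ vanishBelow R k) : a * b ∈ vanishBelow R (j + k) := by
  intro d hd
  rw [coeff_mul]
  refine sum_eq_zero fun p hp => ?_
  rw [HasAntidiagonal.mem_antidiagonal] at hp
  by_cases h : p.1 < j
  · rw [ha _ h, zero_mul]
  · rw [hb p.2 (by omega), mul_zero]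

theorem mem_vanishBelow_zero (a : R⟦X⟧) : a ∈ vanishBelow R 0 :=
  fun _ hd => absurd hd (Nat.not_lt_zero _)

theorem vanishBelow_mul_left {k : ℕ} (a : R⟦X⟧) {b : R⟦X⟧} (hb : b ∈ vanishBelow R k) :
    a * b ∈ vanishBelow R k := by
  simpa using mul_mem_vanishBelow (mem_vanishBelow_zero a) hb

theorem vanishBelow_mul_right {k : ℕ} {a : R⟦X⟧} (b : R⟦X⟧) (ha : a ∈ vanishBelow R k) :
    a * b ∈ vanishBelow R k := by
  simpa using mul_mem_vanishBelow ha (mem_vanishBelow_zero b)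

theorem vanishBelow_antitone : Antitone (vanishBelow R) :=
  fun _ _ h _ ha d hd => ha d (lt_of_lt_of_le hd h)

theorem coeff_mul_of_vanishBelow {k : ℕ} {a b : R⟦X⟧} (ha : a ∈ vanishBelow R k) :
    coeff k (a * b) = coeff k a * coeff 0 b := by
  rw [coeff_mul, sum_eq_single (k, 0)]
  · rintro ⟨i, j⟩ hp hne
    rw [HasAntidiagonal.mem_antidiagonal] at hp
    have : i < k := by
      rcases Nat.eq_zero_or_pos j with h | h
      · exact absurd (by ext <;> simp_all) hne
      · simp only at hp; omega
    rw [ha i this, zero_mul]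
  · intro h
    exact absurd (by simp) h

theorem coeff_mul_of_vanishBelow' {k : ℕ} {a b : R⟦X⟧} (hb : b ∈ vanishBelow R k) :
    coeff k (a * b) = coeff 0 a * coeff k b := by
  rw [coeff_mul, sum_eq_single (0, k)]
  · rintro ⟨i, j⟩ hp hne
    rw [HasAntidiagonal.mem_antidiagonal] at hp
    have : j < k := by
      rcases Nat.eq_zero_or_pos i with h | h
      · exact absurd (by ext <;> simp_all) hne
      · simp only at hp; omega
    rw [hb j this, mul_zero]
  · intro h
    exact absurd (by simp) h

/-- The units of `R⟦X⟧` that are congruent to `1` modulo `X ^ k`. -/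
def congrOne (R : Type*) [Ring R] (k : ℕ) : Subgroup R⟦X⟧ˣ where
  carrier := {g | (g : R⟦X⟧) - 1 ∈ vanishBelow R k}
  one_mem' := by
    change ((1 : R⟦X⟧ˣ) : R⟦X⟧) - 1 ∈ vanishBelow R k
    rw [Units.val_one, sub_self]
    exact zero_mem _
  mul_mem' := by
    intro g h hg hh
    change ((g * h : R⟦X⟧ˣ) : R⟦X⟧) - 1 ∈ vanishBelow R k
    have : ((g * h : R⟦X⟧ˣ) : R⟦X⟧) - 1 = (g - 1) * h + (h - 1) := by
      rw [Units.val_mul]; noncomm_ring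
    rw [this]
    exact add_mem (vanishBelow_mul_right _ hg) hh
  inv_mem' := by
    intro g hg
    change ((g⁻¹ : R⟦X⟧ˣ) : R⟦X⟧) - 1 ∈ vanishBelow R k
    have : ((g⁻¹ : R⟦X⟧ˣ) : R⟦X⟧) - 1 = -(((g⁻¹ : R⟦X⟧ˣ) : R⟦X⟧) * (g - 1)) := by
      rw [mul_sub, Units.inv_mul]; noncomm_ring
    rw [this]
    exact neg_mem (vanishBelow_mul_left _ hg)

theorem mem_congrOne {k : ℕ} {g : R⟦X⟧ˣ} :
    g ∈ congrOne R k ↔ (g : R⟦X⟧) - 1 ∈ vanishBelow R k := Iff.rfl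

theorem congrOne_antitone : Antitone (congrOne R) :=
  fun _ _ h _ hg => vanishBelow_antitone h hg

instance congrOne_normal (k : ℕ) : (congrOne R k).Normal where
  conj_mem g hg h := by
    rw [mem_congrOne] at hg ⊢
    have : ((h * g * h⁻¹ : R⟦X⟧ˣ) : R⟦X⟧) - 1 = h * (g - 1) * (h⁻¹ : R⟦X⟧ˣ) := by
      rw [Units.val_mul, Units.val_mul, mul_sub, sub_mul, mul_one, Units.mul_inv]
    rw [this]
    exact vanishBelow_mul_right _ (vanishBelow_mul_left _ hg)

/-- Since `g h⁻¹ - 1 = (g - h) h⁻¹` with `h` invertible, cosets of the congruence subgroups are read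
off from finitely many coefficients. All later comparisons in quotients go through this. -/
theorem mul_inv_mem_congrOne_iff {k : ℕ} {g h : R⟦X⟧ˣ} :
    g * h⁻¹ ∈ congrOne R k ↔ ∀ d < k, coeff d (g : R⟦X⟧) = coeff d (h : R⟦X⟧) := by
  have h1 : ((g * h⁻¹ : R⟦X⟧ˣ) : R⟦X⟧) - 1 = (g - h) * (h⁻¹ : R⟦X⟧ˣ) := by
    rw [Units.val_mul, sub_mul, Units.mul_inv]
  have h2 : (g : R⟦X⟧) - h = (((g * h⁻¹ : R⟦X⟧ˣ) : R⟦X⟧) - 1) * h := by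
    rw [h1, mul_assoc, Units.inv_mul, mul_one]
  have h3 : (∀ d < k, coeff d (g : R⟦X⟧) = coeff d (h : R⟦X⟧)) ↔
      (g : R⟦X⟧) - h ∈ vanishBelow R k := by
    simp only [mem_vanishBelow, map_sub, sub_eq_zero]
  rw [mem_congrOne, h3]
  constructor
  · intro h
    rw [h2]
    exact vanishBelow_mul_right _ h
  · intro h
    rw [h1]
    exact vanishBelow_mul_right _ h

theorem inv_mul_mem_congrOne_iff {k : ℕ} {g h : R⟦X⟧ˣ} :
    h⁻¹ * g ∈ congrOne R k ↔ ∀ d < k, coeff d (g : R⟦X⟧) = coeff d (h : R⟦X⟧) := by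
  rw [← mul_inv_mem_congrOne_iff, (congrOne_normal k).mem_comm_iff]

/-- A power series with constant coefficient `1`, as a unit. -/
def unitOfCoeffZero (a : R⟦X⟧) (ha : coeff 0 a = 1) : R⟦X⟧ˣ :=
  (isUnit_iff_constantCoeff.2 (by
    rw [← coeff_zero_eq_constantCoeff_apply, ha]; exact isUnit_one)).unit

theorem coe_unitOfCoeffZero (a : R⟦X⟧) (ha : coeff 0 a = 1) :
    (unitOfCoeffZero a ha : R⟦X⟧) = a := rfl

theorem coeff_zero_inv {g : R⟦X⟧ˣ} (hg : coeff 0 (g : R⟦X⟧) = 1) :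
    coeff 0 ((g⁻¹ : R⟦X⟧ˣ) : R⟦X⟧) = 1 := by
  have h := congrArg (coeff 0) (Units.mul_inv g)
  rwa [coeff_mul, Nat.antidiagonal_zero, sum_singleton, hg, one_mul, coeff_zero_one] at h

end Order

/-! ### The Euler derivation and the logarithmic derivative -/

section Euler

variable {R : Type*} [Ring R]

/-- The Euler derivation `X d/dX`. -/
def euler (a : R⟦X⟧) : R⟦X⟧ := PowerSeries.mk fun d => d • coeff d a

theorem coeff_euler (d : ℕ) (a : R⟦X⟧) : coeff d (euler a) = d • coeff d a := coeff_mk _ _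

theorem euler_one : euler (1 : R⟦X⟧) = 0 := by
  ext d
  rw [coeff_euler, coeff_one]
  split_ifs with h <;> simp [h]

theorem euler_mul (a b : R⟦X⟧) : euler (a * b) = euler a * b + a * euler b := by
  ext d
  rw [coeff_euler, map_add, coeff_mul, coeff_mul, coeff_mul, smul_sum, ← sum_add_distrib]
  refine sum_congr rfl fun p hp => ?_
  rw [HasAntidiagonal.mem_antidiagonal] at hp
  rw [coeff_euler, coeff_euler, ← hp, add_smul, smul_mul_assoc, mul_smul_comm]

theorem euler_C (a : R) : euler (C a : R⟦X⟧) = 0 := by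
  ext d
  rw [coeff_euler, coeff_C]
  split_ifs with h <;> simp [h]

theorem euler_mem_vanishBelow {k : ℕ} {a : R⟦X⟧} (ha : a ∈ vanishBelow R k) :
    euler a ∈ vanishBelow R k := fun d hd => by rw [coeff_euler, ha d hd, smul_zero]

theorem euler_sub (a b : R⟦X⟧) : euler (a - b) = euler a - euler b := by
  ext d
  rw [coeff_euler, map_sub, map_sub, coeff_euler, coeff_euler, smul_sub]

/-- The logarithmic derivative of a unit with respect to the Euler derivation. -/
def logDer (g : R⟦X⟧ˣ) : R⟦X⟧ := euler (g : R⟦X⟧) * ((g⁻¹ : R⟦X⟧ˣ) : R⟦X⟧)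

theorem logDer_mul_self (g : R⟦X⟧ˣ) : logDer g * g = euler (g : R⟦X⟧) := by
  rw [logDer, mul_assoc, Units.inv_mul, mul_one]

theorem eq_logDer {g : R⟦X⟧ˣ} {a : R⟦X⟧} (h : a * g = euler (g : R⟦X⟧)) : a = logDer g := by
  rw [logDer, ← h, mul_assoc, Units.mul_inv, mul_one]

theorem logDer_one : logDer (1 : R⟦X⟧ˣ) = 0 := by
  rw [logDer, Units.val_one, euler_one, zero_mul]

/-- The cocycle rule: the logarithmic derivative is additive up to conjugation. It reduces closure
of `expGroup` under products to a statement about conjugation. -/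
theorem logDer_mul (g h : R⟦X⟧ˣ) :
    logDer (g * h) = logDer g + g * logDer h * ((g⁻¹ : R⟦X⟧ˣ) : R⟦X⟧) := by
  symm
  apply eq_logDer
  rw [Units.val_mul, euler_mul, ← logDer_mul_self, ← logDer_mul_self h, add_mul]
  congr 1
  · rw [mul_assoc]
  · rw [mul_assoc _ _ ((g : R⟦X⟧) * h), ← mul_assoc _ (g : R⟦X⟧) (h : R⟦X⟧), Units.inv_mul,
      one_mul, mul_assoc]

theorem logDer_inv (g : R⟦X⟧ˣ) :
    logDer g⁻¹ = -((g⁻¹ : R⟦X⟧ˣ) * logDer g * g) := by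
  have h := logDer_mul g⁻¹ g
  rw [inv_mul_cancel, logDer_one, inv_inv] at h
  exact eq_neg_of_add_eq_zero_left h.symm

theorem coeff_zero_logDer (g : R⟦X⟧ˣ) : coeff 0 (logDer g) = 0 := by
  rw [logDer, coeff_mul, Nat.antidiagonal_zero, sum_singleton, coeff_euler, zero_smul, zero_mul]

/-- The recursion for the coefficients of the logarithmic derivative of a power series with
constant coefficient `1`. -/
def logDerCoeff (u : ℕ → R) (d : ℕ) : R :=
  d • u d - ∑ i : Fin d, logDerCoeff u i * u (d - i)
termination_by d
decreasing_by exact i.2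

/-- Comparing coefficients in `logDer g * g = euler g` expresses those of `logDer g` as
noncommutative polynomials in those of `g`. Hence they depend on finitely many coefficients only,
and polynomially, which serves the `X`-adic and the Zariski arguments respectively. -/
theorem coeff_logDer {g : R⟦X⟧ˣ} (hg : coeff 0 (g : R⟦X⟧) = 1) (d : ℕ) :
    coeff d (logDer g) = logDerCoeff (fun i => coeff i (g : R⟦X⟧)) d := by
  induction d using Nat.strong_induction_on with
  | _ d ih =>
    have h := congrArg (coeff d) (logDer_mul_self g)
    rw [coeff_mul, Nat.sum_antidiagonal_eq_sum_range_succ_mk, sum_range_succ, Nat.sub_self, hg,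
      mul_one, coeff_euler] at h
    rw [logDerCoeff, ← h, eq_sub_iff_add_eq', Fin.sum_univ_eq_sum_range
      (fun i => logDerCoeff (fun i => coeff i (g : R⟦X⟧)) i * coeff (d - i) (g : R⟦X⟧))]
    congr 1
    exact sum_congr rfl fun i hi => by rw [ih i (mem_range.1 hi)]

theorem logDerCoeff_congr {u v : ℕ → R} {k : ℕ} (h : ∀ d < k, u d = v d) :
    ∀ d < k, logDerCoeff u d = logDerCoeff v d := by
  intro d
  induction d using Nat.strong_induction_on with
  | _ d ih =>
    intro hd
    rw [logDerCoeff, logDerCoeff, h d hd]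
    congr 1
    refine sum_congr rfl fun i _ => ?_
    rw [ih i i.2 (i.2.trans hd), h (d - i) (lt_of_le_of_lt (Nat.sub_le _ _) hd)]

end Euler

/-! ### The group attached to a graded Lie algebra of ring elements -/

section Group

variable {R : Type*} [Ring R] [Algebra ℂ R]

/-- The spaces `L i` are the homogeneous components of a positively graded Lie algebra under the
commutator. -/
structure IsGradedLie (L : ℕ → Submodule ℂ R) : Prop where
  zero : L 0 = ⊥
  lie_mem : ∀ i j, ∀ a ∈ L i, ∀ b ∈ L j, a * b - b * a ∈ L (i + j)

/-- The power series whose `d`-th coefficient lies in `L d` for all `d`. -/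
def lieSeries (L : ℕ → Submodule ℂ R) : AddSubgroup R⟦X⟧ where
  carrier := {a | ∀ d, coeff d a ∈ L d}
  add_mem' ha hb d := by rw [map_add]; exact add_mem (ha d) (hb d)
  zero_mem' d := by rw [map_zero]; exact zero_mem _
  neg_mem' ha d := by rw [map_neg]; exact neg_mem (ha d)

/-- Characteristic zero enters here: the `d`-th coefficient of a series is recovered from that of
its Euler derivative by dividing by `d`. -/
theorem mem_of_nsmul_mem {M : Type*} [AddCommGroup M] [Module ℂ M] {W : Submodule ℂ M} {d : ℕ}
    (hd : d ≠ 0) {a : M} (h : d • a ∈ W) : a ∈ W := by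
  have h' : ((d : ℂ)⁻¹) • (d • a) = a := by
    rw [← Nat.cast_smul_eq_nsmul ℂ, smul_smul, inv_mul_cancel₀ (Nat.cast_ne_zero.2 hd), one_smul]
  rw [← h']
  exact W.smul_mem _ h

variable {L : ℕ → Submodule ℂ R}

/-- The conjugate `w` satisfies `euler w = [logDer g, w]`. In degree `d` this writes `d • w_d` as a
sum of commutators of coefficients of `logDer g` in positive degree with coefficients of `w` in
lower degree, so induction applies. -/
theorem conj_C_mem (hL : IsGradedLie L) {g : R⟦X⟧ˣ} (h0 : coeff 0 (g : R⟦X⟧) = 1)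
    (hg : logDer g ∈ lieSeries L) {j : ℕ} {a : R} (ha : a ∈ L j) (d : ℕ) :
    coeff d ((g : R⟦X⟧) * C a * ((g⁻¹ : R⟦X⟧ˣ) : R⟦X⟧)) ∈ L (j + d) := by
  set w : R⟦X⟧ := (g : R⟦X⟧) * C a * ((g⁻¹ : R⟦X⟧ˣ) : R⟦X⟧) with hw
  have hE : euler w = logDer g * w - w * logDer g := by
    have h1 : euler ((g⁻¹ : R⟦X⟧ˣ) : R⟦X⟧) = -((g⁻¹ : R⟦X⟧ˣ) * logDer g) := by
      rw [← logDer_mul_self, logDer_inv, neg_mul, mul_assoc _ (g : R⟦X⟧), Units.mul_inv, mul_one]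
    rw [hw, euler_mul, euler_mul, euler_C, mul_zero, add_zero, h1, ← logDer_mul_self]
    noncomm_ring
  induction d using Nat.strong_induction_on with
  | _ d ih =>
    rcases Nat.eq_zero_or_pos d with rfl | hd
    · rw [hw, coeff_zero_eq_constantCoeff_apply, map_mul, map_mul,
        ← coeff_zero_eq_constantCoeff_apply, ← coeff_zero_eq_constantCoeff_apply,
        ← coeff_zero_eq_constantCoeff_apply, h0, coeff_zero_inv h0, coeff_zero_C, one_mul, mul_one]
      exact ha
    · refine mem_of_nsmul_mem hd.ne' ?_
      rw [← coeff_euler, hE, map_sub, coeff_mul, coeff_mul,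
        ← Finset.Nat.sum_antidiagonal_swap (f := fun p => coeff p.1 w * coeff p.2 (logDer g)),
        ← sum_sub_distrib]
      refine sum_mem fun p hp => ?_
      rw [HasAntidiagonal.mem_antidiagonal] at hp
      simp only [Prod.fst_swap, Prod.snd_swap]
      rcases Nat.eq_zero_or_pos p.1 with h | h
      · rw [h, coeff_zero_logDer, zero_mul, mul_zero, sub_zero]
        exact zero_mem _
      · have := hL.lie_mem _ _ _ (hg p.1) _ (ih p.2 (by omega))
        rwa [show p.1 + (j + p.2) = j + d by omega] at this

theorem conj_mem_lieSeries (hL : IsGradedLie L) {g : R⟦X⟧ˣ} (h0 : coeff 0 (g : R⟦X⟧) = 1)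
    (hg : logDer g ∈ lieSeries L) {y : R⟦X⟧} (hy : y ∈ lieSeries L) :
    (g : R⟦X⟧) * y * ((g⁻¹ : R⟦X⟧ˣ) : R⟦X⟧) ∈ lieSeries L := by
  intro d
  -- Only the terms of `y` up to degree `d` reach coefficient `d`. As `X` is central, each monomial
  -- is handled by `conj_C_mem` with a shift of degree by `j`.
  set t : R⟦X⟧ := ∑ j ∈ range (d + 1), X ^ j * C (coeff j y) with ht
  have hyt : y - t ∈ vanishBelow R (d + 1) := by
    intro e he
    rw [map_sub, ht, map_sum, sub_eq_zero]
    rw [sum_eq_single e]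
    · rw [coeff_mul_C, coeff_X_pow_self, one_mul]
    · intro b _ hb
      rw [coeff_mul_C, coeff_X_pow, if_neg hb.symm, zero_mul]
    · intro h
      exact absurd (mem_range.2 he) h
  have h1 : coeff d ((g : R⟦X⟧) * y * ((g⁻¹ : R⟦X⟧ˣ) : R⟦X⟧)) =
      coeff d ((g : R⟦X⟧) * t * ((g⁻¹ : R⟦X⟧ˣ) : R⟦X⟧)) := by
    rw [← sub_eq_zero, ← map_sub, ← sub_mul, ← mul_sub]
    exact vanishBelow_mul_right _ (vanishBelow_mul_left _ hyt) d (Nat.lt_succ_self d)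
  rw [h1, ht, mul_sum, sum_mul, map_sum]
  refine sum_mem fun j hj => ?_
  rw [← mul_assoc, ← X_pow_mul, mul_assoc, mul_assoc, coeff_X_pow_mul', ← mul_assoc]
  have hj' : j ≤ d := Nat.lt_succ_iff.1 (mem_range.1 hj)
  rw [if_pos hj']
  have := conj_C_mem hL h0 hg (hy j) (d - j)
  rwa [Nat.add_sub_cancel' hj'] at this

/-- The previous lemma cannot be applied to `g⁻¹`, whose logarithmic derivative is not yet known to
be a Lie series; this lemma is what shows it. Instead `z` is solved for degree by degree from `g z
g⁻¹ = y`: conjugation by `g` does not change the leading term. -/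
theorem conj_inv_mem_lieSeries (hL : IsGradedLie L) {g : R⟦X⟧ˣ} (h0 : coeff 0 (g : R⟦X⟧) = 1)
    (hg : logDer g ∈ lieSeries L) {y : R⟦X⟧} (hy : y ∈ lieSeries L) :
    ((g⁻¹ : R⟦X⟧ˣ) : R⟦X⟧) * y * g ∈ lieSeries L := by
  intro d
  set z : R⟦X⟧ := ((g⁻¹ : R⟦X⟧ˣ) : R⟦X⟧) * y * g with hz
  have hyz : (g : R⟦X⟧) * z * ((g⁻¹ : R⟦X⟧ˣ) : R⟦X⟧) = y := by
    rw [hz, mul_assoc _ y, ← mul_assoc, Units.mul_inv, one_mul, mul_assoc, Units.mul_inv, mul_one]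
  induction d using Nat.strong_induction_on with
  | _ d ih =>
    -- The part of `z` already known to be a Lie series. Its conjugate is one too, and subtracting
    -- it from `y` leaves exactly the coefficient `z_d` in degree `d`.
    set z' : R⟦X⟧ := PowerSeries.mk fun e => if e < d then coeff e z else 0 with hz'
    have hz'L : z' ∈ lieSeries L := by
      intro e
      rw [hz', coeff_mk]
      split_ifs with h
      · exact ih e h
      · exact zero_mem _
    have hv : z - z' ∈ vanishBelow R d := by
      intro e he
      rw [map_sub, hz', coeff_mk, if_pos he, sub_self]
    have h1 : coeff d z = coeff d (z - z') := by
      rw [map_sub, hz', coeff_mk, if_neg (lt_irrefl d), sub_zero]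
    have h2 : coeff d ((g : R⟦X⟧) * (z - z') * ((g⁻¹ : R⟦X⟧ˣ) : R⟦X⟧)) = coeff d (z - z') := by
      rw [coeff_mul_of_vanishBelow (vanishBelow_mul_left _ hv), coeff_mul_of_vanishBelow' hv,
        h0, coeff_zero_inv h0, one_mul, mul_one]
    rw [h1, ← h2, mul_sub, sub_mul, hyz, map_sub]
    exact sub_mem (hy d) (conj_mem_lieSeries hL h0 hg hz'L d)

/-- The group of units with constant coefficient `1` and logarithmic derivative in the graded Lie
algebra `L`. -/
def expGroup (hL : IsGradedLie L) : Subgroup R⟦X⟧ˣ where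
  carrier := {g | coeff 0 (g : R⟦X⟧) = 1 ∧ logDer g ∈ lieSeries L}
  one_mem' := ⟨by rw [Units.val_one, coeff_zero_one], by rw [logDer_one]; exact zero_mem _⟩
  mul_mem' := by
    rintro g h ⟨hg0, hg⟩ ⟨hh0, hh⟩
    refine ⟨?_, ?_⟩
    · rw [Units.val_mul, coeff_mul, Nat.antidiagonal_zero, sum_singleton, hg0, hh0, one_mul]
    · rw [logDer_mul]
      exact add_mem hg (conj_mem_lieSeries hL hg0 hg hh)
  inv_mem' := by
    rintro g ⟨hg0, hg⟩
    refine ⟨coeff_zero_inv hg0, ?_⟩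
    rw [logDer_inv]
    exact neg_mem (conj_inv_mem_lieSeries hL hg0 hg hg)

/-- The group is closed in the `X`-adic topology, because coefficient `d` of the logarithmic
derivative involves only the coefficients of `g` up to `d`. -/
theorem mem_expGroup_of_forall_congr {hL : IsGradedLie L} {g : R⟦X⟧ˣ}
    (h : ∀ k, ∃ γ ∈ expGroup hL, ∀ d < k, coeff d (g : R⟦X⟧) = coeff d (γ : R⟦X⟧)) :
    g ∈ expGroup hL := by
  have h0 : coeff 0 (g : R⟦X⟧) = 1 := by
    obtain ⟨γ, hγ, h⟩ := h 1
    rw [h 0 one_pos, hγ.1]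
  refine ⟨h0, fun d => ?_⟩
  obtain ⟨γ, hγ, h⟩ := h (d + 1)
  rw [coeff_logDer h0, logDerCoeff_congr h d (Nat.lt_succ_self d), ← coeff_logDer hγ.1]
  exact hγ.2 d

/-- If `g = 1 + c X ^ k + ⋯`, then its logarithmic derivative begins with `k c X ^ k`. -/
theorem coeff_mem_of_mem_congrOne {hL : IsGradedLie L} {k : ℕ} (hk : 0 < k) {g : R⟦X⟧ˣ}
    (hg : g ∈ expGroup hL) (hgk : g ∈ congrOne R k) : coeff k (g : R⟦X⟧) ∈ L k := by
  refine mem_of_nsmul_mem hk.ne' ?_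
  have h1 : euler (g : R⟦X⟧) = euler ((g : R⟦X⟧) - 1) := by rw [euler_sub, euler_one, sub_zero]
  have h2 := hg.2 k
  rwa [logDer, h1, coeff_mul_of_vanishBelow (euler_mem_vanishBelow hgk), coeff_zero_inv hg.1,
    mul_one, ← h1, coeff_euler] at h2

/-! ### Exponentials of homogeneous elements and infinite products -/

/-- The power series `exp (a X ^ k)`. -/
def expMono (k : ℕ) (a : R) : R⟦X⟧ :=
  PowerSeries.mk fun d => if k ∣ d then ((d / k).factorial : ℂ)⁻¹ • a ^ (d / k) else 0

theorem coeff_expMono_of_lt {k : ℕ} (a : R) {d : ℕ} (hd : d < k) :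
    coeff d (expMono k a) = if d = 0 then 1 else 0 := by
  rw [expMono, coeff_mk]
  rcases Nat.eq_zero_or_pos d with rfl | h
  · simp
  · rw [if_neg (Nat.not_dvd_of_pos_of_lt h hd), if_neg h.ne']

theorem coeff_zero_expMono (k : ℕ) (a : R) : coeff 0 (expMono k a) = 1 := by
  rw [expMono, coeff_mk]
  simp

theorem coeff_self_expMono {k : ℕ} (hk : 0 < k) (a : R) : coeff k (expMono k a) = a := by
  rw [expMono, coeff_mk, if_pos dvd_rfl, Nat.div_self hk]
  simp

theorem coeff_mul_expMono {k : ℕ} (hk : 0 < k) (a : R) (n : ℕ) :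
    coeff (n * k) (expMono k a) = (n.factorial : ℂ)⁻¹ • a ^ n := by
  rw [expMono, coeff_mk, if_pos (dvd_mul_left _ _), Nat.mul_div_cancel _ hk]

/-- `exp (a X ^ k)` as a unit. -/
def expUnit (k : ℕ) (a : R) : R⟦X⟧ˣ := unitOfCoeffZero (expMono k a) (coeff_zero_expMono k a)

theorem coe_expUnit (k : ℕ) (a : R) : (expUnit k a : R⟦X⟧) = expMono k a := rfl

/-- The powers of `a` commute with each other, so the usual equation `X (exp (a X ^ k))' = k a X ^ k
exp (a X ^ k)` holds even though `R` is noncommutative. -/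
theorem logDer_expUnit {k : ℕ} (hk : 0 < k) (a : R) :
    logDer (expUnit k a) = C (k • a) * X ^ k := by
  symm
  apply eq_logDer
  ext d
  rw [coe_expUnit, coeff_euler, mul_assoc, coeff_C_mul, coeff_X_pow_mul']
  by_cases hd : k ∣ d
  · obtain ⟨n, rfl⟩ := hd
    rw [mul_comm k n]
    cases n with
    | zero => rw [if_neg (by omega), Nat.zero_mul, zero_smul, mul_zero]
    | succ n =>
      rw [if_pos (Nat.le_mul_of_pos_left _ n.succ_pos), coeff_mul_expMono hk,
        show (n + 1) * k - k = n * k by rw [Nat.succ_mul, Nat.add_sub_cancel],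
        coeff_mul_expMono hk, pow_succ', smul_mul_assoc, mul_smul_comm, mul_comm (n + 1) k,
        mul_smul]
      congr 1
      rw [← Nat.cast_smul_eq_nsmul ℂ (n + 1), smul_smul, Nat.factorial_succ]
      congr 1
      have h1 : (n.factorial : ℂ) ≠ 0 := Nat.cast_ne_zero.2 n.factorial_ne_zero
      have h2 : ((n + 1 : ℕ) : ℂ) ≠ 0 := Nat.cast_ne_zero.2 n.succ_ne_zero
      push_cast at h2 ⊢
      field_simp
  · have h1 : coeff d (expMono k a) = 0 := by rw [expMono, coeff_mk, if_neg hd]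
    rw [h1, smul_zero]
    split_ifs with h
    · rw [expMono, coeff_mk, if_neg, mul_zero]
      intro h'
      exact hd ((Nat.dvd_sub_iff_left h dvd_rfl).1 h')
    · rw [mul_zero]

theorem expUnit_mem_expGroup (hL : IsGradedLie L) {k : ℕ} (hk : 0 < k) {a : R} (ha : a ∈ L k) :
    expUnit k a ∈ expGroup hL := by
  refine ⟨coeff_zero_expMono k a, fun d => ?_⟩
  rw [logDer_expUnit hk, coeff_C_mul, coeff_X_pow]
  split_ifs with h
  · rw [h, mul_one]
    exact (L k).smul_of_tower_mem k ha
  · rw [mul_zero]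
    exact zero_mem _

theorem expUnit_mem_congrOne (k : ℕ) (a : R) : expUnit k a ∈ congrOne R k := by
  intro d hd
  rw [coe_expUnit, map_sub, coeff_expMono_of_lt a hd, coeff_one, sub_self]

/-- The partial product `exp (a_{n+K-1} X ^ (n+K-1)) ⋯ exp (a_n X ^ n)`. -/
def expPartialProd (a : ℕ → R) (n : ℕ) : ℕ → R⟦X⟧ˣ
  | 0 => 1
  | K + 1 => expUnit (n + K) (a (n + K)) * expPartialProd a n K

theorem expPartialProd_mem (hL : IsGradedLie L) {n : ℕ} (hn : 0 < n) {a : ℕ → R}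
    (ha : ∀ k, n ≤ k → a k ∈ L k) (K : ℕ) :
    expPartialProd a n K ∈ expGroup hL ∧ expPartialProd a n K ∈ congrOne R n := by
  induction K with
  | zero => exact ⟨one_mem _, one_mem _⟩
  | succ K ih =>
    exact ⟨mul_mem (expUnit_mem_expGroup hL (by omega) (ha _ (by omega))) ih.1,
      mul_mem (congrOne_antitone (by omega : n ≤ n + K) (expUnit_mem_congrOne _ _)) ih.2⟩

/-- Each factor added after stage `K` is congruent to `1` modulo `X ^ (n + K)`. -/
theorem coeff_expPartialProd_stable (a : ℕ → R) (n : ℕ) {K K' : ℕ} (h : K ≤ K') :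
    ∀ d < n + K, coeff d (expPartialProd a n K' : R⟦X⟧) =
      coeff d (expPartialProd a n K : R⟦X⟧) := by
  intro d hd
  induction K', h using Nat.le_induction with
  | base => rfl
  | succ K' h ih =>
    rw [← ih]
    refine (mul_inv_mem_congrOne_iff (k := n + K')).1 ?_ d (by omega)
    rw [expPartialProd, mul_inv_cancel_right]
    exact expUnit_mem_congrOne _ _

/-- Infinite products of exponentials lie in the group. -/
theorem exists_expProd (hL : IsGradedLie L) {n : ℕ} (hn : 0 < n) {a : ℕ → R}
    (ha : ∀ k, n ≤ k → a k ∈ L k) :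
    ∃ g ∈ expGroup hL, g ∈ congrOne R n ∧
      ∀ K, ∀ d < n + K, coeff d (g : R⟦X⟧) = coeff d (expPartialProd a n K : R⟦X⟧) := by
  -- The limit is taken diagonally: after `d + 1` factors coefficient `d` no longer changes.
  set u : R⟦X⟧ := PowerSeries.mk fun d => coeff d (expPartialProd a n (d + 1) : R⟦X⟧) with hu
  have hK : ∀ K, ∀ d < n + K, coeff d u = coeff d (expPartialProd a n K : R⟦X⟧) := by
    intro K d hd
    rw [hu, coeff_mk]
    rcases le_total K (d + 1) with h | h
    · exact coeff_expPartialProd_stable a n h d hd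
    · exact (coeff_expPartialProd_stable a n h d (by omega)).symm
  have h0 : coeff 0 u = 1 := by
    rw [hK 0 0 (by omega), expPartialProd, Units.val_one, coeff_zero_one]
  refine ⟨unitOfCoeffZero u h0, ?_, ?_, hK⟩
  · exact mem_expGroup_of_forall_congr fun k =>
      ⟨_, (expPartialProd_mem hL hn ha k).1, fun d hd => hK k d (by omega)⟩
  · intro d hd
    rw [coe_unitOfCoeffZero, map_sub, hK 0 d (by omega), expPartialProd, Units.val_one, sub_self]

/-- The successive remainders in the factorization of a unit into exponentials. -/
def expRemainder (g : R⟦X⟧ˣ) (n : ℕ) : ℕ → R⟦X⟧ˣ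
  | 0 => g
  | K + 1 => expRemainder g n K *
      (expUnit (n + K) (coeff (n + K) (expRemainder g n K : R⟦X⟧)))⁻¹

/-- Every element of the group is an infinite product of exponentials. -/
theorem exists_expPartialProd_eq {hL : IsGradedLie L} {n : ℕ} (hn : 0 < n) {g : R⟦X⟧ˣ}
    (hg : g ∈ expGroup hL) (hgn : g ∈ congrOne R n) :
    ∃ a : ℕ → R, (∀ k, n ≤ k → a k ∈ L k) ∧
      ∀ K, ∀ d < n + K, coeff d (g : R⟦X⟧) = coeff d (expPartialProd a n K : R⟦X⟧) := by
  -- New factors of the partial product are put on the left, so the factorization peels exponentials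
  -- off the right in increasing degree. Dividing by the exponential of the leading term raises the
  -- order of congruence by one.
  have key : ∀ K, expRemainder g n K ∈ expGroup hL ∧ expRemainder g n K ∈ congrOne R (n + K) := by
    intro K
    induction K with
    | zero => exact ⟨hg, hgn⟩
    | succ K ih =>
      have hc := coeff_mem_of_mem_congrOne (by omega) ih.1 ih.2
      refine ⟨mul_mem ih.1 (inv_mem (expUnit_mem_expGroup hL (by omega) hc)), ?_⟩
      rw [expRemainder, mul_inv_mem_congrOne_iff]
      intro d hd
      obtain h | rfl : d < n + K ∨ d = n + K := by omega
      · have := ih.2 d h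
        rw [map_sub, sub_eq_zero] at this
        rw [this, coe_expUnit, coeff_expMono_of_lt _ h, coeff_one]
      · rw [coe_expUnit, coeff_self_expMono (by omega)]
  refine ⟨fun k => coeff k (expRemainder g n (k - n) : R⟦X⟧), fun k hk => ?_, fun K => ?_⟩
  · have := key (k - n)
    rw [Nat.add_sub_cancel' hk] at this
    exact coeff_mem_of_mem_congrOne (by omega) this.1 this.2
  · rw [← mul_inv_mem_congrOne_iff]
    have : ∀ K, g * (expPartialProd (fun k => coeff k (expRemainder g n (k - n) : R⟦X⟧)) n K)⁻¹ =
        expRemainder g n K := by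
      intro K
      induction K with
      | zero => rw [expPartialProd, expRemainder, inv_one, mul_one]
      | succ K ih =>
        rw [expPartialProd, expRemainder, mul_inv_rev, ← mul_assoc, ih, Nat.add_sub_cancel_left]
    rw [this]
    exact (key K).2

end Group

/-! ### Completeness -/

section InverseLimit

variable {R : Type*} [Ring R] [Algebra ℂ R] {L : ℕ → Submodule ℂ R} {hL : IsGradedLie L}
  {Γ : Type*} [Group Γ] (e : Γ ≃* expGroup hL) {N : ℕ+ → Subgroup Γ}

theorem mk_eq_mk_iff_coeff_eq
    (hmem : ∀ k γ, γ ∈ N k ↔ (e γ : R⟦X⟧ˣ) ∈ congrOne R k) (k : ℕ+) (γ γ' : Γ) :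
    (γ : Γ ⧸ N k) = γ' ↔
      ∀ d < (k : ℕ), coeff d ((e γ : R⟦X⟧ˣ) : R⟦X⟧) = coeff d ((e γ' : R⟦X⟧ˣ) : R⟦X⟧) := by
  rw [eq_comm, QuotientGroup.eq, hmem, map_mul, map_inv, Subgroup.coe_mul, Subgroup.coe_inv,
    inv_mul_mem_congrOne_iff]

/-- The group is complete for the filtration by order of congruence to `1`. -/
theorem bijective_toInverseLimit [∀ k, (N k).Normal] (hN : Antitone N)
    (hmem : ∀ k γ, γ ∈ N k ↔ (e γ : R⟦X⟧ˣ) ∈ congrOne R k) :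
    Function.Bijective (toInverseLimit N hN) := by
  constructor
  · intro γ γ' h
    apply e.injective
    apply Subtype.ext
    apply Units.ext
    ext d
    -- Level `d + 1` is the first quotient that sees coefficient `d`.
    have h' : (γ : Γ ⧸ N d.succPNat) = γ' := congrFun (congrArg Subtype.val h) d.succPNat
    exact (mk_eq_mk_iff_coeff_eq e hmem _ _ _).1 h' d (by simp)
  · rintro ⟨y, hy⟩
    choose γ hγ using fun k => QuotientGroup.mk_surjective (y k)
    have hcompat : ∀ i j : ℕ+, i ≤ j → ∀ d < (i : ℕ),
        coeff d ((e (γ j) : R⟦X⟧ˣ) : R⟦X⟧) = coeff d ((e (γ i) : R⟦X⟧ˣ) : R⟦X⟧) := by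
      intro i j hij
      refine (mk_eq_mk_iff_coeff_eq e hmem i (γ j) (γ i)).1 ?_
      have := hy i j hij
      rw [← hγ j] at this
      rw [hγ i, ← this]
      rfl
    set u : R⟦X⟧ :=
      PowerSeries.mk fun d => coeff d ((e (γ d.succPNat) : R⟦X⟧ˣ) : R⟦X⟧) with hu
    have hk : ∀ k : ℕ+, ∀ d < (k : ℕ), coeff d u = coeff d ((e (γ k) : R⟦X⟧ˣ) : R⟦X⟧) := by
      intro k d hd
      rw [hu, coeff_mk]
      exact (hcompat d.succPNat k (by
        rw [← PNat.coe_le_coe, Nat.succPNat_coe]; exact hd) d (by simp)).symm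
    have h0 : coeff 0 u = 1 := by
      rw [hk 1 0 (by simp)]
      exact (e (γ 1)).2.1
    have hg : unitOfCoeffZero u h0 ∈ expGroup hL :=
      mem_expGroup_of_forall_congr fun k => ⟨_, (e (γ k.succPNat)).2, fun d hd =>
        hk k.succPNat d (by rw [Nat.succPNat_coe]; omega)⟩
    refine ⟨e.symm ⟨_, hg⟩, Subtype.ext (funext fun k => ?_)⟩
    refine Eq.trans ?_ (hγ k)
    refine (mk_eq_mk_iff_coeff_eq e hmem k _ (γ k)).2 fun d hd => ?_
    rw [MulEquiv.apply_symm_apply]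
    exact hk k d hd

end InverseLimit

/-! ### Prescribed logarithmic derivatives -/

section Solve

variable {R : Type*} [Ring R] [Algebra ℂ R] {L : ℕ → Submodule ℂ R}

/-- The coefficients of the solution `g` of `euler g = a * g` with constant coefficient `1`. -/
def solveEuler (a : ℕ → R) (d : ℕ) : R :=
  if d = 0 then 1 else (d : ℂ)⁻¹ • ∑ i : Fin d, a (d - i) * solveEuler a i
termination_by d
decreasing_by exact i.2

/-- The equation `euler g = a * g` is a recursion `d • g_d = ∑ a_{d-i} g_i` over `i < d`. The
missing term `i = d` vanishes because `L 0 = ⊥` forces `a_0 = 0`. -/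
theorem exists_logDer_eq (hL : IsGradedLie L) {a : R⟦X⟧} (ha : a ∈ lieSeries L) :
    ∃ g ∈ expGroup hL, logDer g = a := by
  set u : R⟦X⟧ := PowerSeries.mk (solveEuler fun d => coeff d a) with hu
  have h0 : coeff 0 u = 1 := by rw [hu, coeff_mk, solveEuler, if_pos rfl]
  have ha0 : coeff 0 a = 0 := by
    have := ha 0
    rwa [hL.zero, Submodule.mem_bot] at this
  have hlog : a = logDer (unitOfCoeffZero u h0) := by
    apply eq_logDer
    rw [coe_unitOfCoeffZero]
    ext d
    rw [coeff_mul, ← Nat.sum_antidiagonal_swap (f := fun p => coeff p.1 a * coeff p.2 u),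
      Nat.sum_antidiagonal_eq_sum_range_succ_mk, sum_range_succ]
    simp only [Prod.fst_swap, Prod.snd_swap, Nat.sub_self, ha0, zero_mul, add_zero]
    rw [coeff_euler]
    rcases Nat.eq_zero_or_pos d with rfl | hd
    · simp
    · rw [hu, coeff_mk, solveEuler, if_neg hd.ne', ← Nat.cast_smul_eq_nsmul ℂ, smul_smul,
        mul_inv_cancel₀ (Nat.cast_ne_zero.2 hd.ne'), one_smul,
        Fin.sum_univ_eq_sum_range (fun i => coeff (d - i) a * solveEuler (fun d => coeff d a) i)]
      exact sum_congr rfl fun i _ => by rw [coeff_mk]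
  exact ⟨_, ⟨h0, hlog ▸ ha⟩, hlog.symm⟩

theorem logDerCoeff_zero {R : Type*} [Ring R] (u : ℕ → R) : logDerCoeff u 0 = 0 := by
  rw [logDerCoeff]
  simp

/-- Cut the logarithmic derivative off at degree `k`, extend it by zero and solve the equation;
below `k` the solution must agree with `u`, since the recursion determines coefficients from the
logarithmic derivative. Thus the image of the group modulo `X ^ k` is described by conditions on
coefficients below `k` alone. -/
theorem exists_mem_expGroup_coeff_eq (hL : IsGradedLie L) {k : ℕ} {u : ℕ → R} (h0 : u 0 = 1)
    (hu : ∀ d < k, logDerCoeff u d ∈ L d) :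
    ∃ g ∈ expGroup hL, ∀ d < k, coeff d (g : R⟦X⟧) = u d := by
  obtain ⟨g, hg, hlog⟩ := exists_logDer_eq hL
    (a := PowerSeries.mk fun d => if d < k then logDerCoeff u d else 0) (by
      intro d
      rw [coeff_mk]
      split_ifs with h
      · exact hu d h
      · exact zero_mem _)
  have hd : ∀ d < k, logDerCoeff (fun i => coeff i (g : R⟦X⟧)) d = logDerCoeff u d := by
    intro d hd
    rw [← coeff_logDer hg.1, hlog, coeff_mk, if_pos hd]
  refine ⟨g, hg, fun d => ?_⟩
  induction d using Nat.strong_induction_on with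
  | _ d ih =>
    intro hdk
    rcases Nat.eq_zero_or_pos d with rfl | hpos
    · rw [hg.1, h0]
    · have h1 := hd d hdk
      rw [logDerCoeff, logDerCoeff] at h1
      have h2 : ∑ i : Fin d, logDerCoeff (fun i => coeff i (g : R⟦X⟧)) i *
          coeff (d - i) (g : R⟦X⟧) = ∑ i : Fin d, logDerCoeff u i * u (d - i) := by
        refine sum_congr rfl fun i _ => ?_
        rw [hd i (i.2.trans hdk)]
        -- For `i = 0` the factor has index `d`, out of reach of the induction hypothesis, but its
        -- cofactor is `logDerCoeff _ 0 = 0`.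
        rcases Nat.eq_zero_or_pos (i : ℕ) with hi | hi
        · rw [hi, logDerCoeff_zero, zero_mul, zero_mul]
        · rw [ih (d - i) (by omega) (by omega)]
      rw [h2, sub_left_inj, ← sub_eq_zero, ← smul_sub] at h1
      have h3 := mem_of_nsmul_mem (W := (⊥ : Submodule ℂ R)) hpos.ne' ((Submodule.mem_bot ℂ).2 h1)
      rwa [Submodule.mem_bot, sub_eq_zero] at h3

end Solve

/-! ### Polynomial maps and Zariski closure -/

section Poly

variable {σ : Type*} {W W' : Type*} [AddCommGroup W] [Module ℂ W] [AddCommGroup W'] [Module ℂ W']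

/-- The polynomial maps from `ℂ ^ σ` to a vector space `W`. -/
def polyMaps (σ W : Type*) [AddCommGroup W] [Module ℂ W] : Submodule ℂ ((σ → ℂ) → W) :=
  Submodule.span ℂ (Set.range fun pw : MvPolynomial σ ℂ × W => fun x => pw.1.eval x • pw.2)

theorem eval_smul_mem_polyMaps (p : MvPolynomial σ ℂ) (w : W) :
    (fun x => p.eval x • w) ∈ polyMaps σ W := Submodule.subset_span ⟨(p, w), rfl⟩

theorem const_mem_polyMaps (w : W) : (fun _ => w) ∈ polyMaps σ W := by
  simpa using eval_smul_mem_polyMaps (σ := σ) 1 w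

theorem linearMap_comp_mem_polyMaps (φ : W →ₗ[ℂ] W') {F : (σ → ℂ) → W} (hF : F ∈ polyMaps σ W) :
    (fun x => φ (F x)) ∈ polyMaps σ W' := by
  induction hF using Submodule.span_induction with
  | mem F hF =>
    obtain ⟨⟨p, w⟩, rfl⟩ := hF
    simpa using eval_smul_mem_polyMaps p (φ w)
  | zero =>
    simp only [Pi.zero_apply, map_zero]
    exact zero_mem _
  | add F G _ _ hF hG =>
    simp only [Pi.add_apply, map_add]
    exact add_mem hF hG
  | smul c F _ hF =>
    simp only [Pi.smul_apply, map_smul]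
    exact Submodule.smul_mem _ c hF

theorem mul_mem_polyMaps {R : Type*} [Ring R] [Algebra ℂ R] {F G : (σ → ℂ) → R}
    (hF : F ∈ polyMaps σ R) (hG : G ∈ polyMaps σ R) :
    (fun x => F x * G x) ∈ polyMaps σ R := by
  induction hF using Submodule.span_induction with
  | mem F hF =>
    obtain ⟨⟨p, w⟩, rfl⟩ := hF
    induction hG using Submodule.span_induction with
    | mem G hG =>
      obtain ⟨⟨q, v⟩, rfl⟩ := hG
      simpa only [smul_mul_smul_comm, map_mul] using eval_smul_mem_polyMaps (p * q) (w * v)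
    | zero =>
      simp only [Pi.zero_apply, mul_zero]
      exact zero_mem _
    | add G G' _ _ hG hG' =>
      simp only [Pi.add_apply, mul_add]
      exact add_mem hG hG'
    | smul c G _ hG =>
      simp only [Pi.smul_apply, mul_smul_comm]
      exact Submodule.smul_mem _ c hG
  | zero =>
    simp only [Pi.zero_apply, zero_mul]
    exact zero_mem _
  | add F F' _ _ hF hF' =>
    simp only [Pi.add_apply, add_mul]
    exact add_mem hF hF'
  | smul c F _ hF =>
    simp only [Pi.smul_apply, smul_mul_assoc]
    exact Submodule.smul_mem _ c hF

theorem linearMap_mem_polyMaps [Fintype σ] (F : (σ → ℂ) →ₗ[ℂ] W) :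
    (fun x => F x) ∈ polyMaps σ W := by
  classical
  have h : (fun x => F x) =
      ∑ i : σ, fun x : σ → ℂ => (MvPolynomial.X i : MvPolynomial σ ℂ).eval x •
        F (Pi.single i 1) := by
    funext x
    rw [Finset.sum_apply]
    conv_lhs => rw [LinearMap.pi_apply_eq_sum_univ F x]
    refine sum_congr rfl fun i _ => ?_
    rw [MvPolynomial.eval_X]
    congr 2
    funext j
    rw [Pi.single_apply]
    simp only [eq_comm]
  rw [h]
  exact sum_mem fun i _ => eval_smul_mem_polyMaps _ _

theorem exists_eval_eq {F : (σ → ℂ) → ℂ} (hF : F ∈ polyMaps σ ℂ) :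
    ∃ p : MvPolynomial σ ℂ, ∀ x, F x = p.eval x := by
  induction hF using Submodule.span_induction with
  | mem F hF =>
    obtain ⟨⟨p, w⟩, rfl⟩ := hF
    exact ⟨p * MvPolynomial.C w, fun x => by simp⟩
  | zero => exact ⟨0, fun x => by simp⟩
  | add F G _ _ hF hG =>
    obtain ⟨p, hp⟩ := hF
    obtain ⟨q, hq⟩ := hG
    exact ⟨p + q, fun x => by simp [hp, hq]⟩
  | smul c F _ hF =>
    obtain ⟨p, hp⟩ := hF
    exact ⟨MvPolynomial.C c * p, fun x => by simp [hp]⟩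

/-- A linear condition on a polynomial map extends to the Zariski closure. -/
theorem mem_of_forall_eval_eq_zero {S : Set (σ → ℂ)} {x : σ → ℂ}
    (hx : ∀ p : MvPolynomial σ ℂ, (∀ y ∈ S, p.eval y = 0) → p.eval x = 0)
    {F : (σ → ℂ) → W} (hF : F ∈ polyMaps σ W) {W₀ : Submodule ℂ W} (h : ∀ y ∈ S, F y ∈ W₀) :
    F x ∈ W₀ := by
  by_contra hn
  -- A functional killing `W₀` but not `F x` turns the failure of membership into a scalar
  -- polynomial vanishing on `S` and not at `x`.
  obtain ⟨φ, hφ, hker⟩ := Submodule.exists_le_ker_of_notMem hn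
  obtain ⟨p, hp⟩ := exists_eval_eq (linearMap_comp_mem_polyMaps φ hF)
  refine hφ ?_
  rw [hp]
  refine hx p fun y hy => ?_
  rw [← hp]
  exact hker (h y hy)

theorem logDerCoeff_mem_polyMaps {R : Type*} [Ring R] [Algebra ℂ R] {u : ℕ → (σ → ℂ) → R}
    (hu : ∀ d, u d ∈ polyMaps σ R) (d : ℕ) :
    (fun x => logDerCoeff (fun i => u i x) d) ∈ polyMaps σ R := by
  induction d using Nat.strong_induction_on with
  | _ d ih =>
    have : (fun x => logDerCoeff (fun i => u i x) d) =
        d • u d - ∑ i : Fin d, fun x => logDerCoeff (fun i => u i x) i * u (d - i) x := by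
      funext x
      rw [logDerCoeff, Pi.sub_apply, Finset.sum_apply, Pi.smul_apply]
    rw [this]
    exact sub_mem (nsmul_mem (hu d) d) (sum_mem fun i _ => mul_mem_polyMaps (ih i i.2) (hu _))

end Poly

/-! ### The truncated representations -/

section Trunc

variable {R : Type*} [Ring R] [Algebra ℂ R] (L : ℕ → Submodule ℂ R)

/-- The homogeneous components of the associative algebra generated by the `L i`. -/
def envelope (d : ℕ) : Submodule ℂ R :=
  if d = 0 then 1 else ⨆ i : Fin d, L (d - i) * envelope i
termination_by d
decreasing_by exact i.2

theorem one_mem_envelope : (1 : R) ∈ envelope L 0 := by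
  rw [envelope, if_pos rfl]
  exact Submodule.one_le.1 le_rfl

theorem finite_envelope (hfin : ∀ d, Module.Finite ℂ (L d)) (d : ℕ) :
    (envelope L d).FG := by
  induction d using Nat.strong_induction_on with
  | _ d ih =>
    rw [envelope]
    split_ifs
    · rw [Submodule.one_eq_span]
      exact Submodule.fg_span_singleton _
    · exact Submodule.fg_iSup _ fun i =>
        Submodule.FG.mul (Module.Finite.iff_fg.1 (hfin _)) (ih i i.2)

variable {L}

theorem mul_mem_envelope {i j : ℕ} (hi : 0 < i) {a b : R} (ha : a ∈ L i)
    (hb : b ∈ envelope L j) : a * b ∈ envelope L (i + j) := by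
  rw [envelope, if_neg (by omega)]
  refine Submodule.mem_iSup_of_mem (⟨j, by omega⟩ : Fin (i + j)) ?_
  refine Submodule.mul_mem_mul ?_ hb
  simpa using ha

/-- By `euler g = logDer g * g`, the multiple `i • g_i` is a sum of products of an element of some
`L p`, `p > 0`, with a lower coefficient of `g`. So the coefficients of group elements lie in the
associative algebra generated by the `L i`, whose components are finite dimensional when the `L i`
are. -/
theorem coeff_mul_mem_envelope {hL : IsGradedLie L} {g : R⟦X⟧ˣ} (hg : g ∈ expGroup hL) (i : ℕ)
    {j : ℕ} {b : R} (hb : b ∈ envelope L j) :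
    coeff i (g : R⟦X⟧) * b ∈ envelope L (i + j) := by
  induction i using Nat.strong_induction_on with
  | _ i ih =>
    rcases Nat.eq_zero_or_pos i with rfl | hi
    · rwa [hg.1, one_mul, zero_add]
    · refine mem_of_nsmul_mem hi.ne' ?_
      rw [← smul_mul_assoc, ← coeff_euler, ← logDer_mul_self, coeff_mul, sum_mul]
      refine sum_mem fun p hp => ?_
      rw [HasAntidiagonal.mem_antidiagonal] at hp
      rcases Nat.eq_zero_or_pos p.1 with h | h
      · rw [h, coeff_zero_logDer, zero_mul, zero_mul]
        exact zero_mem _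
      · have := mul_mem_envelope h (hg.2 p.1) (ih p.2 (by omega))
        rwa [← add_assoc, hp, ← mul_assoc] at this

/-- Truncation of power series modulo `X ^ k`, as a linear map. -/
def truncate (R : Type*) [Ring R] [Algebra ℂ R] (k : ℕ) : R⟦X⟧ →ₗ[ℂ] R⟦X⟧ where
  toFun a := PowerSeries.mk fun d => if d < k then coeff d a else 0
  map_add' a b := by
    ext d
    rw [map_add, coeff_mk, coeff_mk, coeff_mk, map_add]
    split_ifs <;> simp
  map_smul' c a := by
    ext d
    rw [coeff_mk, RingHom.id_apply, PowerSeries.coeff_smul, PowerSeries.coeff_smul, coeff_mk]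
    split_ifs <;> simp

theorem coeff_truncate (k d : ℕ) (a : R⟦X⟧) :
    coeff d (truncate R k a) = if d < k then coeff d a else 0 :=
  coeff_mk d fun d => if d < k then coeff d a else 0

theorem sub_truncate_mem (k : ℕ) (a : R⟦X⟧) : a - truncate R k a ∈ vanishBelow R k :=
  fun d hd => by rw [map_sub, coeff_truncate, if_pos hd, sub_self]

theorem truncate_eq_truncate_iff {k : ℕ} {a b : R⟦X⟧} :
    truncate R k a = truncate R k b ↔ a - b ∈ vanishBelow R k := by
  constructor
  · intro h d hd
    have := congrArg (coeff d) h
    rwa [coeff_truncate, coeff_truncate, if_pos hd, if_pos hd, ← sub_eq_zero, ← map_sub] at this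
  · intro h
    ext d
    rw [coeff_truncate, coeff_truncate]
    split_ifs with hd
    · rw [← sub_eq_zero, ← map_sub, h d hd]
    · rfl

theorem truncate_mul_truncate (k : ℕ) (a b : R⟦X⟧) :
    truncate R k (a * truncate R k b) = truncate R k (a * b) := by
  rw [eq_comm, truncate_eq_truncate_iff, ← mul_sub]
  exact vanishBelow_mul_left _ (sub_truncate_mem k b)

variable (L)

/-- The truncated power series with `d`-th coefficient in the `d`-th component of the associative
algebra generated by the `L i`. -/
def truncModule (k : ℕ) : Submodule ℂ R⟦X⟧ where
  carrier := {a | ∀ d, coeff d a ∈ envelope L d ∧ (k ≤ d → coeff d a = 0)}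
  add_mem' ha hb d := by
    rw [map_add]
    exact ⟨add_mem (ha d).1 (hb d).1, fun h => by rw [(ha d).2 h, (hb d).2 h, add_zero]⟩
  zero_mem' d := by
    rw [map_zero]
    exact ⟨zero_mem _, fun _ => rfl⟩
  smul_mem' c a ha d := by
    rw [PowerSeries.coeff_smul]
    exact ⟨Submodule.smul_mem _ c (ha d).1, fun h => by rw [(ha d).2 h, smul_zero]⟩

variable {L}

theorem truncate_eq_self {k : ℕ} {a : R⟦X⟧} (ha : a ∈ truncModule L k) : truncate R k a = a := by
  ext d
  rw [coeff_truncate]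
  split_ifs with h
  · rfl
  · exact ((ha d).2 (not_lt.1 h)).symm

theorem truncModule_mono {j k : ℕ} (h : j ≤ k) : truncModule L j ≤ truncModule L k :=
  fun _ ha d => ⟨(ha d).1, fun hd => (ha d).2 (h.trans hd)⟩

theorem truncate_mem_truncModule {k : ℕ} {a : R⟦X⟧} (ha : ∀ d, coeff d a ∈ envelope L d) :
    truncate R k a ∈ truncModule L k := by
  intro d
  rw [coeff_truncate]
  split_ifs with h
  · exact ⟨ha d, fun h' => absurd h (not_lt.2 h')⟩
  · exact ⟨zero_mem _, fun _ => rfl⟩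

theorem one_mem_truncModule {k : ℕ} (hk : 0 < k) : (1 : R⟦X⟧) ∈ truncModule L k := by
  intro d
  rw [coeff_one]
  split_ifs with h
  · rw [h]
    exact ⟨one_mem_envelope L, fun h' => absurd hk (not_lt.2 h')⟩
  · exact ⟨zero_mem _, fun _ => rfl⟩

theorem finite_truncModule (hfin : ∀ d, Module.Finite ℂ (L d)) (k : ℕ) :
    Module.Finite ℂ (truncModule L k) := by
  have : ∀ d, Module.Finite ℂ (envelope L d) := fun d =>
    Module.Finite.iff_fg.2 (finite_envelope L hfin d)
  let F : truncModule L k →ₗ[ℂ] ∀ d : Fin k, envelope L d :=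
    { toFun := fun a d => ⟨coeff d a.1, (a.2 d).1⟩
      map_add' := fun a b => by
        funext d
        exact Subtype.ext (map_add (coeff (d : ℕ)) a.1 b.1)
      map_smul' := fun c a => by
        funext d
        exact Subtype.ext (PowerSeries.coeff_smul (d : ℕ) a.1 c) }
  refine Module.Finite.of_injective F fun a b h => Subtype.ext ?_
  ext d
  by_cases hd : d < k
  · exact congrArg Subtype.val (congrFun h ⟨d, hd⟩)
  · rw [(a.2 d).2 (not_lt.1 hd), (b.2 d).2 (not_lt.1 hd)]

theorem coeff_mul_mem_envelope_of_truncModule {hL : IsGradedLie L} {k : ℕ} {g : R⟦X⟧ˣ}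
    (hg : g ∈ expGroup hL) {a : R⟦X⟧} (ha : a ∈ truncModule L k) (d : ℕ) :
    coeff d ((g : R⟦X⟧) * a) ∈ envelope L d := by
  rw [coeff_mul]
  refine sum_mem fun p hp => ?_
  rw [← HasAntidiagonal.mem_antidiagonal.1 hp]
  exact coeff_mul_mem_envelope hg p.1 (ha p.2).1

/-- The group acts by truncated left multiplication. -/
def truncRep (hL : IsGradedLie L) (k : ℕ) : expGroup hL →* Module.End ℂ (truncModule L k) where
  toFun g := (truncate R k ∘ₗ LinearMap.mulLeft ℂ (g.1 : R⟦X⟧)).restrict fun _ ha =>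
    truncate_mem_truncModule (coeff_mul_mem_envelope_of_truncModule g.2 ha)
  map_one' := by
    refine LinearMap.ext fun a => Subtype.ext ?_
    change truncate R k (1 * a.1) = a.1
    rw [one_mul, truncate_eq_self a.2]
  map_mul' g h := by
    refine LinearMap.ext fun a => Subtype.ext ?_
    change truncate R k ((g.1 : R⟦X⟧) * (h.1 : R⟦X⟧) * a.1) =
      truncate R k ((g.1 : R⟦X⟧) * truncate R k ((h.1 : R⟦X⟧) * a.1))
    rw [truncate_mul_truncate, mul_assoc]

theorem truncRep_apply (hL : IsGradedLie L) (k : ℕ) (g : expGroup hL) (a : truncModule L k) :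
    (truncRep hL k g a : R⟦X⟧) = truncate R k ((g.1 : R⟦X⟧) * a.1) := rfl

/-- The vector `1` is sent to `g` modulo `X ^ k`, so the representation is faithful on the quotient.
-/
theorem truncRep_eq_one_iff {hL : IsGradedLie L} {k : ℕ} (hk : 0 < k) {g : expGroup hL} :
    truncRep hL k g = 1 ↔ (g : R⟦X⟧ˣ) ∈ congrOne R k := by
  constructor
  · intro h
    have h1 := congrArg Subtype.val (LinearMap.congr_fun h ⟨1, one_mem_truncModule hk⟩)
    rw [truncRep_apply, mul_one] at h1
    change _ = (1 : R⟦X⟧) at h1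
    rw [← truncate_eq_self (one_mem_truncModule (L := L) hk), truncate_eq_truncate_iff] at h1
    exact h1
  · intro h
    refine LinearMap.ext fun a => Subtype.ext ?_
    rw [truncRep_apply]
    change _ = a.1
    rw [← truncate_eq_self a.2, truncate_mul_truncate, truncate_eq_truncate_iff]
    have : (g.1 : R⟦X⟧) * a.1 - a.1 = ((g.1 : R⟦X⟧) - 1) * a.1 := by rw [sub_mul, one_mul]
    rw [this]
    exact vanishBelow_mul_right _ h

/-- `g - 1` is divisible by `X`, so each application raises the order of vanishing by one, and
truncated series have no terms from degree `k` on. -/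
theorem truncRep_sub_one_pow (hL : IsGradedLie L) (k : ℕ) (g : expGroup hL) :
    (truncRep hL k g - 1) ^ k = 0 := by
  have key : ∀ n, ∀ a : truncModule L k,
      (((truncRep hL k g - 1) ^ n) a : R⟦X⟧) ∈ vanishBelow R n := by
    intro n
    induction n with
    | zero => exact fun a => mem_vanishBelow_zero _
    | succ n ih =>
      intro a
      rw [pow_succ']
      set b := ((truncRep hL k g - 1) ^ n) a with hb
      change (truncRep hL k g b : R⟦X⟧) - b.1 ∈ _
      rw [truncRep_apply, ← truncate_eq_self b.2, truncate_mul_truncate, ← map_sub]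
      have h1 : (g.1 : R⟦X⟧) * b.1 - b.1 = ((g.1 : R⟦X⟧) - 1) * b.1 := by rw [sub_mul, one_mul]
      rw [h1]
      have h2 : (g.1 : R⟦X⟧) - 1 ∈ vanishBelow R 1 := by
        intro d hd
        rw [Nat.lt_one_iff.1 hd, map_sub, g.2.1, coeff_zero_one, sub_self]
      have h3 := mul_mem_vanishBelow h2 (ih a)
      intro d hd
      rw [coeff_truncate]
      split_ifs
      · exact h3 d (by omega)
      · rfl
  refine LinearMap.ext fun a => Subtype.ext ?_
  ext d
  by_cases hd : d < k
  · rw [key k a d hd]; rfl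
  · rw [((((truncRep hL k g - 1) ^ k) a).2 d).2 (not_lt.1 hd)]; rfl

/-! ### The quotients as unipotent algebraic groups -/

variable (hfin : ∀ d, Module.Finite ℂ (L d))

/-- A basis of the truncated module. -/
def truncBasis (k : ℕ) :
    Module.Basis (Fin (Module.finrank ℂ (truncModule L k))) ℂ (truncModule L k) :=
  have := finite_truncModule hfin k
  Module.finBasis ℂ (truncModule L k)

/-- The matrix form of the truncated representation. -/
def truncMatrix (hL : IsGradedLie L) (k : ℕ) :
    expGroup hL →* Matrix.GeneralLinearGroup (Fin (Module.finrank ℂ (truncModule L k))) ℂ :=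
  MonoidHom.toHomUnits
    ((LinearMap.toMatrixAlgEquiv (truncBasis hfin k) : _ →* _).comp (truncRep hL k))

theorem truncMatrix_val (hL : IsGradedLie L) (k : ℕ) (g : expGroup hL) :
    (truncMatrix hfin hL k g).1 =
      LinearMap.toMatrixAlgEquiv (truncBasis hfin k) (truncRep hL k g) := rfl

theorem ker_truncMatrix (hL : IsGradedLie L) {k : ℕ} (hk : 0 < k) (g : expGroup hL) :
    truncMatrix hfin hL k g = 1 ↔ (g : R⟦X⟧ˣ) ∈ congrOne R k := by
  rw [← truncRep_eq_one_iff hk, Units.ext_iff, truncMatrix_val, Units.val_one,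
    EmbeddingLike.map_eq_one_iff]

/-- The linear endomorphism of the truncated module with given matrix entries, depending linearly
on the entries. -/
def endOfEntries (k : ℕ) :
    (Fin (Module.finrank ℂ (truncModule L k)) × Fin (Module.finrank ℂ (truncModule L k)) → ℂ)
      →ₗ[ℂ] Module.End ℂ (truncModule L k) :=
  (Matrix.toLin (truncBasis hfin k) (truncBasis hfin k)).toLinearMap ∘ₗ
    (LinearEquiv.curry ℂ ℂ _ _).toLinearMap

theorem endOfEntries_val {k : ℕ}
    (g : Matrix (Fin (Module.finrank ℂ (truncModule L k)))
      (Fin (Module.finrank ℂ (truncModule L k))) ℂ) :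
    endOfEntries hfin k (fun ij => g ij.1 ij.2) =
      (LinearMap.toMatrixAlgEquiv (truncBasis hfin k)).symm g := rfl

theorem endOfEntries_truncMatrix (hL : IsGradedLie L) (k : ℕ) (g : expGroup hL) :
    endOfEntries hfin k (fun ij => (truncMatrix hfin hL k g).1 ij.1 ij.2) = truncRep hL k g := by
  rw [endOfEntries_val, truncMatrix_val, AlgEquiv.symm_apply_apply]

/-- The coefficient map as a linear map over the ground field. -/
def coeffLinear (R : Type*) [Ring R] [Algebra ℂ R] (d : ℕ) : R⟦X⟧ →ₗ[ℂ] R where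
  toFun := coeff d
  map_add' := map_add _
  map_smul' c a := PowerSeries.coeff_smul d a c

theorem coeff_endOfEntries_mem_polyMaps (k d : ℕ) (a : truncModule L k) :
    (fun x => coeff d (endOfEntries hfin k x a : R⟦X⟧)) ∈ polyMaps _ R :=
  linearMap_mem_polyMaps (coeffLinear R d ∘ₗ (truncModule L k).subtype ∘ₗ
    LinearMap.applyₗ a ∘ₗ endOfEntries hfin k)

/-- A point of the Zariski closure inherits every linear condition on polynomial maps that holds on
the image (`mem_of_forall_eval_eq_zero`). Three such conditions characterize the image: the vector
`h 1` has constant coefficient `1`, its logarithmic derivative has coefficients in `L`, and `h` is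
truncated left multiplication by `h 1`. The first two produce a group element, the third identifies
its action with `h`. -/
theorem mem_range_truncMatrix (hL : IsGradedLie L) {k : ℕ} (hk : 0 < k)
    {g : Matrix.GeneralLinearGroup (Fin (Module.finrank ℂ (truncModule L k))) ℂ}
    (hg : ∀ p : MvPolynomial _ ℂ,
      (∀ γ : expGroup hL, p.eval (fun ij => (truncMatrix hfin hL k γ).1 ij.1 ij.2) = 0) →
        p.eval (fun ij : _ × _ => g.1 ij.1 ij.2) = 0) :
    g ∈ (truncMatrix hfin hL k).range := by
  set S : Set (Fin (Module.finrank ℂ (truncModule L k)) ×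
      Fin (Module.finrank ℂ (truncModule L k)) → ℂ) :=
    Set.range fun γ : expGroup hL => fun ij => (truncMatrix hfin hL k γ).1 ij.1 ij.2 with hS
  have hx : ∀ p : MvPolynomial _ ℂ, (∀ y ∈ S, p.eval y = 0) →
      p.eval (fun ij : _ × _ => g.1 ij.1 ij.2) = 0 :=
    fun p hp => hg p fun γ => hp _ ⟨γ, rfl⟩
  set one : truncModule L k := ⟨1, one_mem_truncModule hk⟩ with hone
  set h := endOfEntries hfin k (fun ij => g.1 ij.1 ij.2) with hh
  have hu : ∀ (γ : expGroup hL) (d : ℕ), d < k →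
      coeff d (endOfEntries hfin k (fun ij => (truncMatrix hfin hL k γ).1 ij.1 ij.2) one : R⟦X⟧) =
        coeff d (γ.1 : R⟦X⟧) := by
    intro γ d hd
    rw [endOfEntries_truncMatrix, truncRep_apply, coeff_truncate, if_pos hd, mul_one]
  have h0 : coeff 0 (h one : R⟦X⟧) = 1 := by
    have := mem_of_forall_eval_eq_zero hx (W₀ := ⊥)
      (sub_mem (coeff_endOfEntries_mem_polyMaps hfin k 0 one) (const_mem_polyMaps (1 : R))) (by
        rintro _ ⟨γ, rfl⟩
        rw [Submodule.mem_bot, Pi.sub_apply, hu γ 0 hk, γ.2.1, sub_self])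
    rwa [Submodule.mem_bot, Pi.sub_apply, sub_eq_zero] at this
  have h1 : ∀ d < k, logDerCoeff (fun i => coeff i (h one : R⟦X⟧)) d ∈ L d := by
    intro d hd
    refine mem_of_forall_eval_eq_zero hx (logDerCoeff_mem_polyMaps
      (fun i => coeff_endOfEntries_mem_polyMaps hfin k i one) d) ?_
    rintro _ ⟨γ, rfl⟩
    rw [logDerCoeff_congr (fun d hd => hu γ d hd) d hd, ← coeff_logDer γ.2.1]
    exact γ.2.2 d
  -- For fixed `a`, the coefficients of `h a` minus those of the product of `h 1` and `a` are
  -- polynomial in the entries of `h` and vanish on the image.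
  have h2 : ∀ (a : truncModule L k) (d : ℕ), d < k → coeff d (h a : R⟦X⟧) =
      ∑ p ∈ antidiagonal d, coeff p.1 (h one : R⟦X⟧) * coeff p.2 a.1 := by
    intro a d hd
    have := mem_of_forall_eval_eq_zero hx (W₀ := ⊥)
      (sub_mem (coeff_endOfEntries_mem_polyMaps hfin k d a)
        (sum_mem fun p (_ : p ∈ antidiagonal d) =>
          mul_mem_polyMaps (coeff_endOfEntries_mem_polyMaps hfin k p.1 one)
            (const_mem_polyMaps (coeff p.2 a.1)))) (by
        rintro _ ⟨γ, rfl⟩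
        rw [Submodule.mem_bot, Pi.sub_apply, Finset.sum_apply, sub_eq_zero,
          endOfEntries_truncMatrix, truncRep_apply, coeff_truncate, if_pos hd, coeff_mul]
        refine sum_congr rfl fun p hp => ?_
        rw [HasAntidiagonal.mem_antidiagonal] at hp
        have := hu γ p.1 (by omega)
        rw [endOfEntries_truncMatrix] at this
        rw [this])
    rwa [Submodule.mem_bot, Pi.sub_apply, Finset.sum_apply, sub_eq_zero] at this
  obtain ⟨γ, hγ, hγu⟩ := exists_mem_expGroup_coeff_eq hL h0 h1
  refine ⟨⟨γ, hγ⟩, Units.ext ?_⟩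
  rw [truncMatrix_val]
  refine (AlgEquiv.eq_symm_apply _).1 ?_
  rw [← endOfEntries_val]
  refine LinearMap.ext fun a => Subtype.ext ?_
  rw [truncRep_apply]
  ext d
  rw [coeff_truncate]
  split_ifs with hd
  · rw [h2 a d hd, coeff_mul]
    refine sum_congr rfl fun p hp => ?_
    rw [HasAntidiagonal.mem_antidiagonal] at hp
    rw [hγu p.1 (by omega)]
  · exact (((h a).2 d).2 (not_lt.1 hd)).symm

/-- The image of the group in the truncated representation is a unipotent algebraic group. -/
def truncGroup (hL : IsGradedLie L) (k : ℕ) (hk : 0 < k) : UnipotentAlgebraicGroup where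
  n := Module.finrank ℂ (truncModule L k)
  group := (truncMatrix hfin hL k).range
  closed := by
    refine ⟨{p | ∀ γ : expGroup hL,
      p.eval (fun ij => (truncMatrix hfin hL k γ).1 ij.1 ij.2) = 0}, fun g => ⟨?_, ?_⟩⟩
    · rintro ⟨γ, rfl⟩ p hp
      exact hp γ
    · exact fun h => mem_range_truncMatrix hfin hL hk h
  unipotent := by
    rintro _ ⟨γ, rfl⟩
    refine ⟨k, ?_⟩
    rw [truncMatrix_val, ← map_one (LinearMap.toMatrixAlgEquiv (truncBasis hfin k)), ← map_sub,
      ← map_pow, truncRep_sub_one_pow, map_zero]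

/-- Truncation from level `k` to level `j`. -/
def truncProj (j k : ℕ) : truncModule L k →ₗ[ℂ] truncModule L j :=
  (truncate R j).restrict fun _ ha => truncate_mem_truncModule fun d => (ha d).1

/-- Level `j` is a compression of level `k`, so the transition map on matrices is even linear in the
entries. -/
theorem truncRep_eq_comp (hL : IsGradedLie L) {j k : ℕ} (hjk : j ≤ k) (g : expGroup hL) :
    truncRep hL j g = truncProj j k ∘ₗ truncRep hL k g ∘ₗ
      Submodule.inclusion (truncModule_mono hjk) := by
  refine LinearMap.ext fun a => Subtype.ext ?_
  change truncate R j _ = truncate R j (truncate R k _)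
  rw [truncate_eq_truncate_iff]
  exact vanishBelow_antitone hjk (sub_truncate_mem k _)

theorem exists_polynomial_truncMatrix (hL : IsGradedLie L) {j k : ℕ} (hjk : j ≤ k) :
    ∃ p : Fin (Module.finrank ℂ (truncModule L j)) → Fin (Module.finrank ℂ (truncModule L j)) →
      MvPolynomial _ ℂ, ∀ (g : expGroup hL) a b, (truncMatrix hfin hL j g).1 a b =
        (p a b).eval (fun ij : _ × _ => (truncMatrix hfin hL k g).1 ij.1 ij.2) := by
  have key : ∀ a b, ∃ p : MvPolynomial _ ℂ, ∀ g : expGroup hL, (truncMatrix hfin hL j g).1 a b =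
      p.eval (fun ij : _ × _ => (truncMatrix hfin hL k g).1 ij.1 ij.2) := by
    intro a b
    obtain ⟨p, hp⟩ := exists_eval_eq (linearMap_mem_polyMaps
      ((truncBasis hfin j).coord a ∘ₗ truncProj j k ∘ₗ
        LinearMap.applyₗ (Submodule.inclusion (truncModule_mono hjk) (truncBasis hfin j b)) ∘ₗ
          endOfEntries hfin k))
    refine ⟨p, fun g => ?_⟩
    rw [← hp, LinearMap.comp_apply, LinearMap.comp_apply, LinearMap.comp_apply,
      endOfEntries_truncMatrix, truncMatrix_val, LinearMap.toMatrixAlgEquiv_apply,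
      truncRep_eq_comp hL hjk]
    rfl
  choose p hp using key
  exact ⟨p, fun g a b => hp a b g⟩

end Trunc

/-! ### Transfer to a filtered group isomorphic to the group of series -/

section System

variable {R : Type*} [Ring R] [Algebra ℂ R] {L : ℕ → Submodule ℂ R} {hL : IsGradedLie L}
  {Γ : Type*} [Group Γ] (e : Γ ≃* expGroup hL) {N : ℕ+ → Subgroup Γ}

/-- The quotients of the group are unipotent algebraic groups, and the transition maps are
morphisms. -/
theorem isUnipotentSystem (hfin : ∀ d, Module.Finite ℂ (L d)) [∀ k, (N k).Normal] (hN : Antitone N)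
    (hmem : ∀ k γ, γ ∈ N k ↔ (e γ : R⟦X⟧ˣ) ∈ congrOne R k) : IsUnipotentSystem N hN := by
  let ψ : ∀ k : ℕ+, Γ →* (truncGroup hfin hL k k.pos).group := fun k =>
    (truncMatrix hfin hL k).rangeRestrict.comp e.toMonoidHom
  have hψ : ∀ k, Function.Surjective (ψ k) := fun k =>
    (MonoidHom.rangeRestrict_surjective _).comp e.surjective
  have hker : ∀ k, N k = (ψ k).ker := by
    intro k
    ext γ
    refine (hmem k γ).trans ((ker_truncMatrix hfin hL k.pos (e γ)).symm.trans ?_)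
    rw [MonoidHom.mem_ker]
    exact ⟨fun h => Subtype.ext h, fun h => congrArg Subtype.val h⟩
  let E : ∀ k, Γ ⧸ N k ≃* (truncGroup hfin hL k k.pos).group := fun k =>
    (QuotientGroup.quotientMulEquivOfEq (hker k)).trans
      (QuotientGroup.quotientKerEquivOfSurjective (ψ k) (hψ k))
  have hE : ∀ k (γ : Γ), E k (γ : Γ ⧸ N k) = ψ k γ := fun k γ => rfl
  refine ⟨fun k => truncGroup hfin hL k k.2, E, fun i j hij => ?_⟩
  obtain ⟨p, hp⟩ := exists_polynomial_truncMatrix hfin hL ((PNat.coe_le_coe i j).2 hij)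
  refine ⟨p, fun g a b => ?_⟩
  obtain ⟨γ, rfl⟩ := hψ j g
  have h1 : (E j).symm (ψ j γ) = (γ : Γ ⧸ N j) := by
    rw [MulEquiv.symm_apply_eq, hE]
  have h2 : (((E i).toMonoidHom.comp (transition N hN hij)).comp (E j).symm.toMonoidHom) (ψ j γ) =
      ψ i γ := by
    change E i (transition N hN hij ((E j).symm (ψ j γ))) = _
    rw [h1]
    exact hE i γ
  rw [h2]
  exact hp (e γ) a b

end System

/-! ### Finite dimensionality of the root spaces -/

section Triangular

variable {l : ℕ} {𝔤 𝔥 : Type*} [LieRing 𝔤] [LieAlgebra ℂ 𝔤] [AddCommGroup 𝔥] [Module ℂ 𝔥]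

/-- The iterated bracket `⁅e i₁, ⁅e i₂, ⋯ e iᵣ⁆⁆`. -/
def iterBracket (e : Fin l → 𝔤) : List (Fin l) → 𝔤
  | [] => 0
  | [i] => e i
  | i :: j :: w => ⁅e i, iterBracket e (j :: w)⁆

theorem iterBracket_cons {𝔤 : Type*} [LieRing 𝔤] {e : Fin l → 𝔤} (i : Fin l)
    {w : List (Fin l)} (hw : w ≠ []) :
    iterBracket e (i :: w) = ⁅e i, iterBracket e w⁆ := by
  cases w with
  | nil => exact absurd rfl hw
  | cons j w => rfl

theorem lie_iterBracket_weight {H : 𝔥 → 𝔤} {e : Fin l → 𝔤} {α : Fin l → Module.Dual ℂ 𝔥}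
    (he : ∀ x i, ⁅H x, e i⁆ = α i x • e i) (x : 𝔥) (w : List (Fin l)) :
    ⁅H x, iterBracket e w⁆ = (w.map α).sum x • iterBracket e w := by
  induction w with
  | nil => simp [iterBracket]
  | cons i w ih =>
    rcases eq_or_ne w [] with rfl | hw
    · simp [iterBracket, he]
    · rw [iterBracket_cons i hw, leibniz_lie, he, ih, smul_lie, lie_smul, ← add_smul,
        List.map_cons, List.sum_cons, LinearMap.add_apply]

/-- The span of the Cartan subalgebra and the iterated brackets of the `e i`. -/
def borelSpan (H : 𝔥 →ₗ[ℂ] 𝔤) (e : Fin l → 𝔤) : Submodule ℂ 𝔤 :=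
  LinearMap.range H ⊔ Submodule.span ℂ (Set.range (iterBracket e))

theorem iterBracket_mem_borelSpan (H : 𝔥 →ₗ[ℂ] 𝔤) (e : Fin l → 𝔤) (w : List (Fin l)) :
    iterBracket e w ∈ borelSpan H e :=
  Submodule.mem_sup_right (Submodule.subset_span ⟨w, rfl⟩)

theorem mem_borelSpan_of_H (H : 𝔥 →ₗ[ℂ] 𝔤) (e : Fin l → 𝔤) (x : 𝔥) : H x ∈ borelSpan H e :=
  Submodule.mem_sup_left ⟨x, rfl⟩

theorem lie_mem_of_borelSpan {H : 𝔥 →ₗ[ℂ] 𝔤} {e : Fin l → 𝔤} {T : Submodule ℂ 𝔤} {y : 𝔤}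
    (hH : ∀ x, ⁅y, H x⁆ ∈ T) (he : ∀ w, ⁅y, iterBracket e w⁆ ∈ T) {z : 𝔤}
    (hz : z ∈ borelSpan H e) : ⁅y, z⁆ ∈ T := by
  have : borelSpan H e ≤ T.comap (LieAlgebra.ad ℂ 𝔤 y : 𝔤 →ₗ[ℂ] 𝔤) := by
    refine sup_le ?_ (Submodule.span_le.2 ?_)
    · rintro _ ⟨x, rfl⟩
      exact hH x
    · rintro _ ⟨w, rfl⟩
      exact he w
  exact this hz

theorem lie_H_mem_borelSpan {H : 𝔥 →ₗ[ℂ] 𝔤} {e : Fin l → 𝔤} {α : Fin l → Module.Dual ℂ 𝔥}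
    (hH : ∀ x y, ⁅H x, H y⁆ = 0) (he : ∀ x i, ⁅H x, e i⁆ = α i x • e i) (x : 𝔥) {z : 𝔤}
    (hz : z ∈ borelSpan H e) : ⁅H x, z⁆ ∈ borelSpan H e := by
  refine lie_mem_of_borelSpan (fun y => ?_) (fun w => ?_) hz
  · rw [hH]; exact zero_mem _
  · rw [lie_iterBracket_weight he]
    exact Submodule.smul_mem _ _ (iterBracket_mem_borelSpan H e w)

theorem lie_e_mem_borelSpan {H : 𝔥 →ₗ[ℂ] 𝔤} {e : Fin l → 𝔤} {α : Fin l → Module.Dual ℂ 𝔥}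
    (he : ∀ x i, ⁅H x, e i⁆ = α i x • e i) (i : Fin l) {z : 𝔤}
    (hz : z ∈ borelSpan H e) : ⁅e i, z⁆ ∈ borelSpan H e := by
  refine lie_mem_of_borelSpan (fun y => ?_) (fun w => ?_) hz
  · rw [← lie_skew, he]
    exact neg_mem (Submodule.smul_mem _ _ (iterBracket_mem_borelSpan H e [i]))
  · rcases eq_or_ne w [] with rfl | hw
    · rw [iterBracket, lie_zero]; exact zero_mem _
    · rw [← iterBracket_cons i hw]
      exact iterBracket_mem_borelSpan H e _

/-- Moving `f i` through an iterated bracket by the Jacobi identity produces only brackets with `⁅f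
i, e j⁆`, an element of the Cartan part, which acts on iterated brackets by scalars. The weights `α`
and `β` are kept independent so that the roles of `e` and `f` can be exchanged. -/
theorem lie_f_mem_borelSpan {H : 𝔥 →ₗ[ℂ] 𝔤} {e f : Fin l → 𝔤} {α β : Fin l → Module.Dual ℂ 𝔥}
    {c : Fin l → 𝔥} (he : ∀ x i, ⁅H x, e i⁆ = α i x • e i)
    (hf : ∀ x i, ⁅H x, f i⁆ = β i x • f i)
    (hef : ∀ i j, ⁅e i, f j⁆ = if i = j then H (c i) else 0) (i : Fin l) {z : 𝔤}
    (hz : z ∈ borelSpan H e) : ⁅f i, z⁆ ∈ borelSpan H e ⊔ borelSpan H f := by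
  refine lie_mem_of_borelSpan (fun y => ?_) (fun w => ?_) hz
  · rw [← lie_skew, hf]
    exact Submodule.mem_sup_right
      (neg_mem (Submodule.smul_mem _ _ (iterBracket_mem_borelSpan H f [i])))
  · refine Submodule.mem_sup_left ?_
    induction w with
    | nil => rw [iterBracket, lie_zero]; exact zero_mem _
    | cons j w ih =>
      have h1 : ⁅f i, e j⁆ = -(if j = i then H (c j) else 0) := by rw [← lie_skew, hef]
      rcases eq_or_ne w [] with rfl | hw
      · rw [iterBracket, h1]
        split_ifs
        · exact neg_mem (mem_borelSpan_of_H H e _)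
        · rw [neg_zero]; exact zero_mem _
      · rw [iterBracket_cons j hw, leibniz_lie, h1]
        refine add_mem ?_ (lie_e_mem_borelSpan he j ih)
        split_ifs
        · rw [neg_lie, lie_iterBracket_weight he]
          exact neg_mem (Submodule.smul_mem _ _ (iterBracket_mem_borelSpan H e w))
        · rw [neg_zero, zero_lie]; exact zero_mem _

end Triangular

/-! ### Triangular spanning set of the Kac–Moody algebra and its root spaces -/

section Roots

variable {l : ℕ} {A : Matrix (Fin l) (Fin l) ℤ} {𝔥 : Type*} [AddCommGroup 𝔥] [Module ℂ 𝔥]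
  (R : Realization A 𝔥)

/-- The quotient map from the free Lie algebra to the Kac--Moody algebra. -/
def Realization.proj : FreeAlg l 𝔥 →ₗ⁅ℂ⁆ R.LieAlg where
  toFun y := LieSubmodule.Quotient.mk (N := R.relIdeal) y
  map_add' _ _ := rfl
  map_smul' _ _ := rfl
  map_lie' {_ _} := rfl

theorem Realization.proj_surjective : Function.Surjective R.proj :=
  LieSubmodule.Quotient.surjective_mk' R.relIdeal

theorem Realization.proj_eq_zero_of_relator {y : FreeAlg l 𝔥} (hy : R.Relator y) : R.proj y = 0 :=
  (LieSubmodule.Quotient.mk_eq_zero (N := R.relIdeal)).2 (LieSubmodule.subset_lieSpan hy)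

/-- The inclusion of the Cartan subalgebra, as a linear map. -/
def Realization.Hₗ : 𝔥 →ₗ[ℂ] R.LieAlg where
  toFun := R.H
  map_add' x y := by
    have h := R.proj_eq_zero_of_relator (.h_add x y)
    rwa [map_sub, map_add, sub_eq_zero] at h
  map_smul' c x := by
    have h := R.proj_eq_zero_of_relator (.h_smul c x)
    rwa [map_sub, map_smul, sub_eq_zero] at h

/-- The Chevalley generator `e i`. -/
def Realization.E (i : Fin l) : R.LieAlg := R.proj (ge 𝔥 i)

/-- The Chevalley generator `f i`. -/
def Realization.F (i : Fin l) : R.LieAlg := R.proj (gf 𝔥 i)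

theorem Realization.lie_H_H (x y : 𝔥) : ⁅R.Hₗ x, R.Hₗ y⁆ = 0 := by
  have h := R.proj_eq_zero_of_relator (.h_h x y)
  rwa [LieHom.map_lie] at h

theorem Realization.lie_H_E (x : 𝔥) (i : Fin l) : ⁅R.Hₗ x, R.E i⁆ = R.root i x • R.E i := by
  have h := R.proj_eq_zero_of_relator (.h_e x i)
  rwa [map_sub, LieHom.map_lie, map_smul, sub_eq_zero] at h

theorem Realization.lie_H_F (x : 𝔥) (i : Fin l) :
    ⁅R.Hₗ x, R.F i⁆ = (-R.root i) x • R.F i := by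
  have h := R.proj_eq_zero_of_relator (.h_f x i)
  rw [map_add, LieHom.map_lie, map_smul] at h
  rw [LinearMap.neg_apply, neg_smul]
  exact eq_neg_of_add_eq_zero_left h

theorem Realization.lie_E_F (i j : Fin l) :
    ⁅R.E i, R.F j⁆ = if i = j then R.Hₗ (R.coroot i) else 0 := by
  split_ifs with hij
  · subst hij
    have h := R.proj_eq_zero_of_relator (.e_f_same i)
    rwa [map_sub, LieHom.map_lie, sub_eq_zero] at h
  · have h := R.proj_eq_zero_of_relator (.e_f_ne i j hij)
    rwa [LieHom.map_lie] at h

/-- A Lie subalgebra containing the generators of a free Lie algebra is everything. -/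
theorem mem_of_forall_of_mem {X : Type*} (K : LieSubalgebra ℂ (FreeLieAlgebra ℂ X))
    (hK : ∀ x, FreeLieAlgebra.of ℂ x ∈ K) (y : FreeLieAlgebra ℂ X) : y ∈ K := by
  have h : K.incl.comp (FreeLieAlgebra.lift ℂ fun x => (⟨_, hK x⟩ : K)) = LieHom.id := by
    ext x
    simp
  have h' := LieHom.congr_fun h y
  rw [LieHom.comp_apply, LieHom.id_apply] at h'
  rw [← h']
  exact Subtype.property _

/-- A subspace that contains the generators and is stable under bracketing with them is
everything. -/
theorem Realization.eq_top_of_stable {T : Submodule ℂ R.LieAlg} (hH : ∀ x, R.Hₗ x ∈ T)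
    (hE : ∀ i, R.E i ∈ T) (hF : ∀ i, R.F i ∈ T) (hH' : ∀ x, ∀ z ∈ T, ⁅R.Hₗ x, z⁆ ∈ T)
    (hE' : ∀ i, ∀ z ∈ T, ⁅R.E i, z⁆ ∈ T) (hF' : ∀ i, ∀ z ∈ T, ⁅R.F i, z⁆ ∈ T) : T = ⊤ := by
  -- The elements whose bracket preserves `T` form a subalgebra containing the generators, hence
  -- everything. Then `T` is stable under all brackets, so its preimage `K'` is itself a subalgebra
  -- containing the generators.
  let K : LieSubalgebra ℂ (FreeAlg l 𝔥) :=
    { carrier := {y | ∀ z ∈ T, ⁅R.proj y, z⁆ ∈ T}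
      add_mem' := fun ha hb z hz => by
        rw [map_add, add_lie]
        exact add_mem (ha z hz) (hb z hz)
      zero_mem' := fun z _ => by
        rw [map_zero, zero_lie]
        exact zero_mem _
      smul_mem' := fun c a ha z hz => by
        rw [map_smul, smul_lie]
        exact T.smul_mem c (ha z hz)
      lie_mem' := fun {a b} ha hb z hz => by
        rw [LieHom.map_lie, lie_lie]
        exact sub_mem (ha _ (hb z hz)) (hb _ (ha z hz)) }
  have hK : ∀ y, y ∈ K := mem_of_forall_of_mem K (by
    rintro (x | i | i)
    · exact hH' x
    · exact hE' i
    · exact hF' i)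
  let K' : LieSubalgebra ℂ (FreeAlg l 𝔥) :=
    { T.comap (R.proj : FreeAlg l 𝔥 →ₗ[ℂ] R.LieAlg) with
      lie_mem' := fun {a b} _ hb => by
        change R.proj ⁅a, b⁆ ∈ T
        rw [LieHom.map_lie]
        exact hK a _ hb }
  rw [eq_top_iff]
  intro y _
  obtain ⟨y, rfl⟩ := R.proj_surjective y
  refine mem_of_forall_of_mem K' ?_ y
  rintro (x | i | i)
  · exact hH x
  · exact hE i
  · exact hF i

theorem Realization.borelSpan_sup_eq_top : borelSpan R.Hₗ R.E ⊔ borelSpan R.Hₗ R.F = ⊤ := by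
  have hFE : ∀ i j, ⁅R.F i, R.E j⁆ = if i = j then R.Hₗ (-R.coroot i) else 0 := by
    intro i j
    rw [← lie_skew, R.lie_E_F]
    by_cases h : i = j
    · rw [if_pos h, if_pos h.symm, h, map_neg]
    · rw [if_neg h, if_neg (Ne.symm h), neg_zero]
  have hsup : ∀ {y : R.LieAlg} {T₁ T₂ T : Submodule ℂ R.LieAlg}, (∀ z ∈ T₁, ⁅y, z⁆ ∈ T) →
      (∀ z ∈ T₂, ⁅y, z⁆ ∈ T) → ∀ z ∈ T₁ ⊔ T₂, ⁅y, z⁆ ∈ T := by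
    intro y T₁ T₂ T h₁ h₂ z hz
    obtain ⟨a, ha, b, hb, rfl⟩ := Submodule.mem_sup.1 hz
    rw [lie_add]
    exact add_mem (h₁ a ha) (h₂ b hb)
  refine R.eq_top_of_stable (fun x => Submodule.mem_sup_left (mem_borelSpan_of_H _ _ x))
    (fun i => Submodule.mem_sup_left (iterBracket_mem_borelSpan _ R.E [i]))
    (fun i => Submodule.mem_sup_right (iterBracket_mem_borelSpan _ R.F [i]))
    (fun x => ?_) (fun i => ?_) (fun i => ?_)
  · exact hsup
      (fun z hz => Submodule.mem_sup_left (lie_H_mem_borelSpan R.lie_H_H R.lie_H_E x hz))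
      (fun z hz => Submodule.mem_sup_right (lie_H_mem_borelSpan (α := fun i => -R.root i)
        R.lie_H_H R.lie_H_F x hz))
  · refine hsup (fun z hz => Submodule.mem_sup_left (lie_e_mem_borelSpan R.lie_H_E i hz))
      (fun z hz => ?_)
    rw [sup_comm]
    exact lie_f_mem_borelSpan (α := fun i => -R.root i) R.lie_H_F R.lie_H_E hFE i hz
  · exact hsup (fun z hz => lie_f_mem_borelSpan R.lie_H_E (β := fun i => -R.root i) R.lie_H_F
      R.lie_E_F i hz) (fun z hz => Submodule.mem_sup_right
        (lie_e_mem_borelSpan (α := fun i => -R.root i) R.lie_H_F i hz))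

/-- Root spaces sit inside the simultaneous generalized eigenspaces of the commuting operators `ad
h`, which are independent. -/
theorem Realization.iSupIndep_rootSpace : iSupIndep R.rootSpace := by
  have hcomm : ∀ x y, Commute (LieAlgebra.ad ℂ R.LieAlg (R.H x) : Module.End ℂ R.LieAlg)
      (LieAlgebra.ad ℂ R.LieAlg (R.H y)) := by
    intro x y
    refine LinearMap.ext fun z => ?_
    change ⁅R.Hₗ x, ⁅R.Hₗ y, z⁆⁆ = ⁅R.Hₗ y, ⁅R.Hₗ x, z⁆⁆
    rw [leibniz_lie, R.lie_H_H, zero_lie, zero_add]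
  have h := Module.End.independent_iInf_maxGenEigenspace_of_forall_mapsTo
    (fun x : 𝔥 => (LieAlgebra.ad ℂ R.LieAlg (R.H x) : Module.End ℂ R.LieAlg))
    (fun x y c => Module.End.mapsTo_maxGenEigenspace_of_comm (hcomm y x) c)
  have h' := h.comp (f := fun μ : Module.Dual ℂ 𝔥 => (μ : 𝔥 → ℂ)) DFunLike.coe_injective
  refine h'.mono fun μ z hz => ?_
  refine (Submodule.mem_iInf _).2 fun x => ?_
  refine Module.End.mem_maxGenEigenspace _ _ _ |>.2 ⟨1, ?_⟩
  rw [pow_one, LinearMap.sub_apply, sub_eq_zero]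
  exact hz x

/-- If a family of weight vectors spans, then each weight space is spanned by the members of the
family of that weight. -/
theorem Realization.rootSpace_le_span {J : Type*} {s : J → R.LieAlg}
    {wt : J → Module.Dual ℂ 𝔥} (hs : ∀ j, s j ∈ R.rootSpace (wt j))
    (hspan : Submodule.span ℂ (Set.range s) = ⊤) (α : Module.Dual ℂ 𝔥) :
    R.rootSpace α ≤ Submodule.span ℂ (s '' {j | wt j = α}) := by
  set T := Submodule.span ℂ (s '' {j | wt j = α}) with hT
  have hTα : T ≤ R.rootSpace α := by
    refine Submodule.span_le.2 ?_
    rintro _ ⟨j, rfl, rfl⟩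
    exact hs j
  have htop : T ⊔ ⨆ (μ) (_ : μ ≠ α), R.rootSpace μ = ⊤ := by
    rw [eq_top_iff, ← hspan, Submodule.span_le]
    rintro _ ⟨j, rfl⟩
    by_cases hj : wt j = α
    · exact Submodule.mem_sup_left (Submodule.subset_span ⟨j, hj, rfl⟩)
    · exact Submodule.mem_sup_right
        (Submodule.mem_iSup_of_mem (wt j) (Submodule.mem_iSup_of_mem hj (hs j)))
  intro y hy
  obtain ⟨a, ha, b, hb, rfl⟩ := Submodule.mem_sup.1 (htop ▸ Submodule.mem_top : y ∈ _)
  have hbα : b ∈ R.rootSpace α := by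
    have := sub_mem hy (hTα ha)
    rwa [add_sub_cancel_left] at this
  have hb0 : b = 0 := (Submodule.disjoint_def.1 (R.iSupIndep_rootSpace α)) b hbα hb
  rwa [hb0, add_zero]

/-- The simple roots are linearly independent, hence extend to a basis of the dual. The height
separates words in the `e i` from words in the `f i` and bounds their length. -/
theorem Realization.exists_height : ∃ ht : Module.Dual ℂ 𝔥 →ₗ[ℂ] ℂ, ∀ i, ht (R.root i) = 1 := by
  refine ⟨(Module.Basis.extend R.root_linearIndependent.linearIndepOn_id).constr ℂ fun _ => 1,
    fun i => ?_⟩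
  have := (Module.Basis.extend R.root_linearIndependent.linearIndepOn_id).constr_basis ℂ
    (fun _ => (1 : ℂ))
    ⟨R.root i, R.root_linearIndependent.linearIndepOn_id.subset_extend _ ⟨i, rfl⟩⟩
  rwa [Module.Basis.extend_apply_self] at this

theorem height_sum {α : Fin l → Module.Dual ℂ 𝔥} {ht : Module.Dual ℂ 𝔥 →ₗ[ℂ] ℂ} {c : ℂ}
    (h : ∀ i, ht (α i) = c) (w : List (Fin l)) : ht (w.map α).sum = w.length * c := by
  induction w with
  | nil => simp
  | cons i w ih =>
    rw [List.map_cons, List.sum_cons, map_add, h, ih, List.length_cons]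
    push_cast
    ring

theorem height_mem_QPlus {ht : Module.Dual ℂ 𝔥 →ₗ[ℂ] ℂ} (h : ∀ i, ht (R.root i) = 1)
    {α : Module.Dual ℂ 𝔥} (hα : α ∈ R.QPlus) : ∃ n : ℕ, ht α = n ∧ (n = 0 → α = 0) := by
  induction hα using AddSubmonoid.closure_induction with
  | mem α hα =>
    obtain ⟨i, rfl⟩ := hα
    exact ⟨1, by rw [h]; simp, fun h => absurd h one_ne_zero⟩
  | zero => exact ⟨0, by simp, fun _ => rfl⟩
  | add α β _ _ hα hβ =>
    obtain ⟨n, hn, hn'⟩ := hα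
    obtain ⟨m, hm, hm'⟩ := hβ
    refine ⟨n + m, by rw [map_add, hn, hm]; push_cast; rfl, fun h => ?_⟩
    rw [hn' (by omega), hm' (by omega), add_zero]

/-- The root space of a positive root is finite dimensional. -/
theorem Realization.finite_rootSpace {α : Module.Dual ℂ 𝔥} (hα : R.IsPosRoot α) :
    Module.Finite ℂ (R.rootSpace α) := by
  obtain ⟨ht, hht⟩ := R.exists_height
  obtain ⟨n, hn, hn0⟩ := height_mem_QPlus R hht hα.2
  have hα0 : α ≠ 0 := hα.1.1
  let s : 𝔥 ⊕ (List (Fin l) ⊕ List (Fin l)) → R.LieAlg :=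
    Sum.elim R.Hₗ (Sum.elim (iterBracket R.E) (iterBracket R.F))
  let wt : 𝔥 ⊕ (List (Fin l) ⊕ List (Fin l)) → Module.Dual ℂ 𝔥 :=
    Sum.elim (fun _ => 0) (Sum.elim (fun w => (w.map R.root).sum)
      (fun w => (w.map fun i => -R.root i).sum))
  have hs : ∀ j, s j ∈ R.rootSpace (wt j) := by
    rintro (x | w | w) y
    · exact (R.lie_H_H y x).trans (zero_smul _ _).symm
    · exact lie_iterBracket_weight R.lie_H_E y w
    · exact lie_iterBracket_weight (α := fun i => -R.root i) R.lie_H_F y w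
  have hspan : Submodule.span ℂ (Set.range s) = ⊤ := by
    rw [eq_top_iff, ← R.borelSpan_sup_eq_top]
    have hH : LinearMap.range R.Hₗ ≤ Submodule.span ℂ (Set.range s) := by
      rintro _ ⟨x, rfl⟩
      exact Submodule.subset_span ⟨Sum.inl x, rfl⟩
    refine sup_le (sup_le hH (Submodule.span_mono ?_)) (sup_le hH (Submodule.span_mono ?_))
    · rintro _ ⟨w, rfl⟩
      exact ⟨Sum.inr (Sum.inl w), rfl⟩
    · rintro _ ⟨w, rfl⟩
      exact ⟨Sum.inr (Sum.inr w), rfl⟩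
  have hle := R.rootSpace_le_span hs hspan α
  -- Of the spanning weight vectors, only words of length `n` in the `e i` can have weight `α` of
  -- height `n`. Elements of the Cartan part have weight `0`, and a word in the `f i` has height
  -- `-length`, which would force `n = 0` and `α = 0`.
  have hfin : (s '' {j | wt j = α}).Finite := by
    refine ((List.finite_length_eq (Fin l) n).image (iterBracket R.E)).subset ?_
    rintro _ ⟨x | w | w, hj, rfl⟩
    · exact absurd hj.symm hα0
    · refine ⟨w, ?_, rfl⟩
      have h1 := height_sum hht w
      rw [show (w.map R.root).sum = α from hj, hn, mul_one] at h1
      exact_mod_cast h1.symm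
    · exfalso
      have h1 := height_sum (α := fun i => -R.root i) (c := -1)
        (fun i => by rw [map_neg, hht]) w
      rw [show (w.map fun i => -R.root i).sum = α from hj, hn] at h1
      have h2 : ((n + w.length : ℕ) : ℂ) = 0 := by
        push_cast
        rw [h1]
        ring
      have h3 : n + w.length = 0 := by exact_mod_cast h2
      exact hα0 (hn0 (by omega))
  have := Module.Finite.iff_fg.2 (Submodule.fg_span (R := ℂ) hfin)
  exact Submodule.finiteDimensional_of_le hle

theorem Realization.finite_gPart {P : AddSubgroup (Module.Dual ℂ 𝔥)} {f : P →+ ℤ} {m : ℤ}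
    (hfin : (R.rootsDeg f m).Finite) (hpos : ∀ α ∈ R.rootsDeg f m, R.IsPosRoot α) :
    Module.Finite ℂ (R.gPart f m) := by
  have : Finite (R.rootsDeg f m) := hfin
  refine Module.Finite.iff_fg.2 (Submodule.fg_iSup _ fun α => ?_)
  exact Module.Finite.iff_fg.1 (R.finite_rootSpace (hpos α α.2))

theorem Realization.lie_mem_gPart {P : AddSubgroup (Module.Dual ℂ 𝔥)} (f : P →+ ℤ) {k m : ℤ}
    {x y : R.LieAlg} (hx : x ∈ R.gPart f k) (hy : y ∈ R.gPart f m) :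
    ⁅x, y⁆ ∈ R.gPart f (k + m) := by
  refine Submodule.iSup_induction _ (motive := fun x => ⁅x, y⁆ ∈ R.gPart f (k + m)) hx
    ?_ (by simp) (fun a b ha hb => by rw [add_lie]; exact add_mem ha hb)
  rintro ⟨α, _, hαP, hα⟩ z hz
  refine Submodule.iSup_induction _ (motive := fun v => ⁅z, v⁆ ∈ R.gPart f (k + m)) hy
    ?_ (by simp) (fun a b ha hb => by rw [lie_add]; exact add_mem ha hb)
  rintro ⟨β, _, hβP, hβ⟩ w hw
  have hmem := R.lie_mem_weightSpace hz hw
  by_cases h0 : R.rootSpace (α + β) = ⊥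
  · rw [Realization.rootSpace] at h0
    rw [h0, Submodule.mem_bot] at hmem
    rw [hmem]
    exact zero_mem _
  · refine Submodule.mem_iSup_of_mem
      (p := fun ν : R.rootsDeg f (k + m) => R.rootSpace ν.1)
      ⟨α + β, ?_, add_mem hαP hβP, ?_⟩ hmem
    · by_cases h : α + β = 0
      · exact Or.inr h
      · exact Or.inl ⟨h, h0⟩
    · rw [← hα, ← hβ, ← map_add]
      rfl

end Roots

section Action

variable {l : ℕ} {A : Matrix (Fin l) (Fin l) ℤ} {𝔥 : Type*} [AddCommGroup 𝔥] [Module ℂ 𝔥]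
  (R : Realization A 𝔥) (V : Type*) [AddCommGroup V] [Module ℂ V]
  [LieRingModule R.LieAlg V] [LieModule ℂ R.LieAlg V]
  {P : AddSubgroup (Module.Dual ℂ 𝔥)} (f : P →+ ℤ)

/-! ### The graded Lie algebra of operators on the module -/

/-- The action of the Lie algebra on `V`, as a linear map. -/
def Realization.actLinear : R.LieAlg →ₗ[ℂ] Module.End ℂ V :=
  LinearMap.mk₂ ℂ (fun x v => ⁅x, v⁆) add_lie smul_lie lie_add fun c x v => lie_smul c x v

/-- The operators on `V` by elements of `𝔤_d`, `d ≥ 1`. -/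
def Realization.opPart (d : ℕ) : Submodule ℂ (Module.End ℂ V) :=
  if d = 0 then ⊥ else (R.gPart f (d : ℤ)).map (R.actLinear V)

theorem Realization.mem_opPart {d : ℕ} (hd : 0 < d) {a : Module.End ℂ V} :
    a ∈ R.opPart V f d ↔ ∃ x ∈ R.gPart f (d : ℤ), R.actLinear V x = a := by
  rw [opPart, if_neg hd.ne']
  rfl

theorem Realization.isGradedLie_opPart : IsGradedLie (R.opPart V f) where
  zero := if_pos rfl
  lie_mem := by
    intro i j a ha b hb
    rcases Nat.eq_zero_or_pos i with rfl | hi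
    · rw [opPart, if_pos rfl, Submodule.mem_bot] at ha
      rw [ha, zero_mul, mul_zero, sub_zero]
      exact zero_mem _
    rcases Nat.eq_zero_or_pos j with rfl | hj
    · rw [opPart, if_pos rfl, Submodule.mem_bot] at hb
      rw [hb, zero_mul, mul_zero, sub_zero]
      exact zero_mem _
    obtain ⟨x, hx, rfl⟩ := (R.mem_opPart V f hi).1 ha
    obtain ⟨y, hy, rfl⟩ := (R.mem_opPart V f hj).1 hb
    refine (R.mem_opPart V f (by omega)).2 ⟨⁅x, y⁆, ?_, ?_⟩
    · rw [Nat.cast_add]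
      exact R.lie_mem_gPart f hx hy
    · refine LinearMap.ext fun v => ?_
      exact lie_lie x y v

variable {V f} in
theorem Realization.IsStandardGraded.finite_opPart (hV : R.IsStandardGraded V f) (d : ℕ) :
    Module.Finite ℂ (R.opPart V f d) := by
  by_cases h : d = 0
  · rw [opPart, if_pos h]
    infer_instance
  · have hd : (0 : ℤ) < d := by omega
    have := R.finite_gPart (hV.finite_roots d) (hV.roots_pos d hd)
    rw [opPart, if_neg h]
    exact Module.Finite.map _ _

/-- The linear operators on `V` that are homogeneous of degree `d`. -/
def Realization.homDeg (d : ℕ) : Submodule ℂ (Module.End ℂ V) where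
  carrier := {a | ∀ m, ∀ v ∈ R.vPart V f m, a v ∈ R.vPart V f (d + m)}
  add_mem' ha hb m v hv := add_mem (ha m v hv) (hb m v hv)
  zero_mem' _ _ _ := zero_mem _
  smul_mem' c _ ha m v hv := Submodule.smul_mem _ c (ha m v hv)

theorem Realization.one_mem_homDeg : (1 : Module.End ℂ V) ∈ R.homDeg V f 0 := by
  intro m v hv
  rw [Nat.cast_zero, zero_add]
  exact hv

theorem Realization.mul_mem_homDeg {i j : ℕ} {a b : Module.End ℂ V} (ha : a ∈ R.homDeg V f i)
    (hb : b ∈ R.homDeg V f j) : a * b ∈ R.homDeg V f (i + j) := by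
  intro m v hv
  rw [Nat.cast_add, add_assoc]
  exact ha _ _ (hb m v hv)

theorem Realization.opPart_le_homDeg (d : ℕ) : R.opPart V f d ≤ R.homDeg V f d := by
  rcases Nat.eq_zero_or_pos d with rfl | hd
  · rw [opPart, if_pos rfl]
    exact bot_le
  · intro a ha
    obtain ⟨x, hx, rfl⟩ := (R.mem_opPart V f hd).1 ha
    exact fun m v hv => R.lie_mem_vPart f hx hv

theorem Realization.envelope_le_homDeg (d : ℕ) : envelope (R.opPart V f) d ≤ R.homDeg V f d := by
  induction d using Nat.strong_induction_on with
  | _ d ih =>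
    rw [envelope]
    split_ifs with h
    · rw [h]
      exact Submodule.one_le.2 (R.one_mem_homDeg V f)
    · refine iSup_le fun i => Submodule.mul_le.2 fun a ha b hb => ?_
      have := R.mul_mem_homDeg V f (R.opPart_le_homDeg V f _ ha) (ih i i.2 hb)
      rwa [Nat.sub_add_cancel i.2.le] at this

/-- The power series of operators whose `d`-th coefficient is homogeneous of degree `d`. -/
def Realization.homSeries : Subring (Module.End ℂ V)⟦X⟧ where
  carrier := {a | ∀ d, coeff d a ∈ R.homDeg V f d}
  mul_mem' ha hb d := by
    rw [coeff_mul]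
    refine sum_mem fun p hp => ?_
    rw [← HasAntidiagonal.mem_antidiagonal.1 hp]
    exact R.mul_mem_homDeg V f (ha _) (hb _)
  one_mem' d := by
    rw [coeff_one]
    split_ifs with h
    · rw [h]
      exact R.one_mem_homDeg V f
    · exact zero_mem _
  add_mem' ha hb d := by rw [map_add]; exact add_mem (ha d) (hb d)
  zero_mem' d := by rw [map_zero]; exact zero_mem _
  neg_mem' ha d := by rw [map_neg]; exact neg_mem (ha d)

/-- Coefficients of group elements lie in the associative algebra generated by the `L d`, where
degrees add. -/
theorem Realization.mem_homSeries_of_expGroup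
    (g : expGroup (R.isGradedLie_opPart V f)) : (g.1 : (Module.End ℂ V)⟦X⟧) ∈ R.homSeries V f := by
  intro d
  have := coeff_mul_mem_envelope g.2 d (one_mem_envelope (R.opPart V f))
  rw [mul_one, add_zero] at this
  exact R.envelope_le_homDeg V f d this

/-! ### The action on the completion -/

theorem Realization.support_opSeries_subset (a : (Module.End ℂ V)⟦X⟧) {v : R.completion V f}
    {N : ℤ} (hN : ∀ m < N, v.1 m = 0) {m : ℤ} {K : ℕ} (hm : m < N + K) :
    (Function.support fun i : ℕ => coeff i a (v.1 (m - i))) ⊆ range K := by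
  intro i hi
  by_contra h
  refine hi ?_
  have h' : K ≤ i := by simpa using h
  change coeff i a (v.1 (m - i)) = 0
  rw [hN _ (by omega), map_zero]

theorem Realization.finite_support_opSeries (a : (Module.End ℂ V)⟦X⟧) (v : R.completion V f)
    (m : ℤ) : (Function.support fun i : ℕ => coeff i a (v.1 (m - i))).Finite := by
  obtain ⟨-, N, hN⟩ := v.2
  exact (range ((m - N).toNat + 1)).finite_toSet.subset
    (R.support_opSeries_subset V f a hN (by omega))

theorem Realization.finsum_opSeries (a : (Module.End ℂ V)⟦X⟧) {v : R.completion V f}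
    {N : ℤ} (hN : ∀ m < N, v.1 m = 0) {m : ℤ} {K : ℕ} (hm : m < N + K) :
    ∑ᶠ i : ℕ, coeff i a (v.1 (m - i)) = ∑ i ∈ range K, coeff i a (v.1 (m - i)) :=
  finsum_eq_sum_of_support_subset _ (R.support_opSeries_subset V f a hN hm)

/-- The action of a series of homogeneous operators on the completion. -/
def Realization.opSeries (a : R.homSeries V f) : Module.End ℂ (R.completion V f) where
  toFun v := ⟨fun m => ∑ᶠ i : ℕ, coeff i a.1 (v.1 (m - i)), by
    obtain ⟨hv, N, hN⟩ := v.2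
    refine ⟨fun m => ?_, N, fun m hm => ?_⟩
    · refine finsum_induction (· ∈ R.vPart V f m) (zero_mem _) (fun _ _ => add_mem) fun i => ?_
      have := a.2 i _ _ (hv (m - i))
      rwa [add_sub_cancel] at this
    · change ∑ᶠ i : ℕ, coeff i a.1 (v.1 (m - i)) = 0
      rw [R.finsum_opSeries V f a.1 hN (K := 0) (by simpa using hm), range_zero, sum_empty]⟩
  map_add' v w := by
    apply Subtype.ext
    funext m
    change ∑ᶠ i : ℕ, coeff i a.1 ((v + w).1 (m - i)) =
      ∑ᶠ i : ℕ, coeff i a.1 (v.1 (m - i)) + ∑ᶠ i : ℕ, coeff i a.1 (w.1 (m - i))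
    rw [← finsum_add_distrib (R.finite_support_opSeries V f a.1 v m)
      (R.finite_support_opSeries V f a.1 w m)]
    exact finsum_congr fun i => map_add _ _ _
  map_smul' c v := by
    apply Subtype.ext
    funext m
    change ∑ᶠ i : ℕ, coeff i a.1 ((c • v).1 (m - i)) = c • ∑ᶠ i : ℕ, coeff i a.1 (v.1 (m - i))
    rw [smul_finsum]
    exact finsum_congr fun i => map_smul _ _ _

theorem Realization.opSeries_apply (a : R.homSeries V f) {v : R.completion V f}
    {N : ℤ} (hN : ∀ m < N, v.1 m = 0) {m : ℤ} {K : ℕ} (hm : m < N + K) :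
    (R.opSeries V f a v).1 m = ∑ i ∈ range K, coeff i a.1 (v.1 (m - i)) :=
  R.finsum_opSeries V f a.1 hN hm

theorem Realization.opSeries_vanish (a : R.homSeries V f) {v : R.completion V f}
    {N : ℤ} {k : ℕ} (ha : a.1 ∈ vanishBelow _ k) (hN : ∀ m < N, v.1 m = 0) :
    ∀ m < N + k, (R.opSeries V f a v).1 m = 0 := by
  intro m hm
  rw [R.opSeries_apply V f a hN hm]
  refine sum_eq_zero fun i hi => ?_
  rw [ha i (mem_range.1 hi), LinearMap.zero_apply]

theorem Realization.opSeries_congr {a b : R.homSeries V f} {v : R.completion V f}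
    {N : ℤ} (hN : ∀ m < N, v.1 m = 0) {m : ℤ} {K : ℕ} (hm : m < N + K)
    (hab : ∀ d < K, coeff d a.1 = coeff d b.1) :
    (R.opSeries V f a v).1 m = (R.opSeries V f b v).1 m := by
  rw [R.opSeries_apply V f a hN hm, R.opSeries_apply V f b hN hm]
  exact sum_congr rfl fun i hi => by rw [hab i (mem_range.1 hi)]

theorem Realization.opSeries_one : R.opSeries V f 1 = 1 := by
  refine LinearMap.ext fun v => Subtype.ext (funext fun m => ?_)
  obtain ⟨-, N, hN⟩ := v.2
  rw [R.opSeries_apply V f 1 hN (K := (m - N).toNat + 1) (by omega), sum_eq_single 0]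
  · rw [Subring.coe_one, coeff_zero_one, Nat.cast_zero, sub_zero]
    rfl
  · intro i _ hi
    rw [Subring.coe_one, coeff_one, if_neg hi, LinearMap.zero_apply]
  · simp

theorem Realization.opSeries_mul (a b : R.homSeries V f) :
    R.opSeries V f (a * b) = R.opSeries V f a * R.opSeries V f b := by
  refine LinearMap.ext fun v => Subtype.ext (funext fun m => ?_)
  obtain ⟨-, N, hN⟩ := v.2
  -- A window large enough that `v` vanishes in degree `m - i` for all `i ≥ K`; all three sums
  -- become finite, and the double sum is regrouped along antidiagonals.
  set K := (m - N).toNat + 1 with hK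
  have hNb : ∀ m < N, (R.opSeries V f b v).1 m = 0 := by
    simpa using R.opSeries_vanish V f b (mem_vanishBelow_zero _) hN
  change _ = (R.opSeries V f a (R.opSeries V f b v)).1 m
  rw [R.opSeries_apply V f _ hN (K := K) (by omega),
    R.opSeries_apply V f _ hNb (K := K) (by omega)]
  have h1 : ∀ d, coeff d (a * b).1 (v.1 (m - d)) = ∑ i ∈ range (d + 1),
      coeff i a.1 (coeff (d - i) b.1 (v.1 (m - i - ((d - i : ℕ) : ℤ)))) := by
    intro d
    rw [Subring.coe_mul, coeff_mul, Nat.sum_antidiagonal_eq_sum_range_succ_mk,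
      LinearMap.sum_apply]
    refine sum_congr rfl fun i hi => ?_
    rw [Nat.cast_sub (Nat.lt_succ_iff.1 (mem_range.1 hi)), sub_sub, add_sub_cancel]
    rfl
  rw [sum_congr rfl fun d _ => h1 d, sum_range_diag_flip K fun i j =>
    coeff i a.1 (coeff j b.1 (v.1 (m - i - (j : ℤ))))]
  refine sum_congr rfl fun i hi => ?_
  have hi' := mem_range.1 hi
  rw [R.opSeries_apply V f b hN (K := K - i) (by omega), map_sum]

theorem Realization.opSeries_sub (a b : R.homSeries V f) :
    R.opSeries V f (a - b) = R.opSeries V f a - R.opSeries V f b := by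
  refine LinearMap.ext fun v => Subtype.ext (funext fun m => ?_)
  obtain ⟨-, N, hN⟩ := v.2
  change _ = (R.opSeries V f a v).1 m - (R.opSeries V f b v).1 m
  rw [R.opSeries_apply V f _ hN (K := (m - N).toNat + 1) (by omega),
    R.opSeries_apply V f _ hN (K := (m - N).toNat + 1) (by omega),
    R.opSeries_apply V f _ hN (K := (m - N).toNat + 1) (by omega), ← sum_sub_distrib]
  refine sum_congr rfl fun i _ => ?_
  rw [AddSubgroupClass.coe_sub, map_sub, LinearMap.sub_apply]

/-- A vector of degree `m`, as an element of the completion. -/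
def Realization.single {m : ℤ} (v : R.vPart V f m) : R.completion V f :=
  ⟨Pi.single m v.1, by
    refine ⟨fun n => ?_, m, fun n hn => Pi.single_eq_of_ne hn.ne _⟩
    rcases eq_or_ne n m with rfl | h
    · rw [Pi.single_eq_same]
      exact v.2
    · rw [Pi.single_eq_of_ne h]
      exact zero_mem _⟩

theorem Realization.single_vanish {m : ℤ} (v : R.vPart V f m) :
    ∀ n < m, (R.single V f v).1 n = 0 := fun _ hn => Pi.single_eq_of_ne hn.ne _

theorem Realization.opSeries_single (a : R.homSeries V f) {m : ℤ} (v : R.vPart V f m) (d : ℕ) :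
    (R.opSeries V f a (R.single V f v)).1 (m + d) = coeff d a.1 v.1 := by
  rw [R.opSeries_apply V f a (R.single_vanish V f v) (K := d + 1) (by push_cast; omega),
    sum_eq_single d]
  · rw [add_sub_cancel_right]
    change coeff d a.1 ((Pi.single m v.1 : ℤ → V) m) = _
    rw [Pi.single_eq_same]
  · intro i _ hi
    change coeff i a.1 ((Pi.single m v.1 : ℤ → V) (m + d - i)) = _
    rw [Pi.single_eq_of_ne (by omega), map_zero]
  · simp

/-! ### Recovering a series from its action on the completion -/

variable {V f}

/-- Every weight lies in `P`, so it has a degree and its weight space lies in some `V_m`. -/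
theorem Realization.IsStandardGraded.iSup_vPart (hV : R.IsStandardGraded V f) :
    ⨆ m, R.vPart V f m = ⊤ := by
  rw [eq_top_iff, ← hV.weightModule.span]
  refine iSup_le fun μ => ?_
  by_cases hμ : R.weightSpace V μ = ⊥
  · rw [hμ]
    exact bot_le
  · have hP := hV.weight_mem μ hμ
    refine le_trans ?_ (le_iSup _ (f ⟨μ, hP⟩))
    exact le_iSup (fun ν : R.wtsDeg V f (f ⟨μ, hP⟩) => R.weightSpace V ν.1) ⟨μ, hμ, hP, rfl⟩

theorem Realization.IsStandardGraded.end_eq_zero (hV : R.IsStandardGraded V f)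
    {a : Module.End ℂ V} (ha : ∀ m, ∀ v ∈ R.vPart V f m, a v = 0) : a = 0 := by
  have : (⊤ : Submodule ℂ V) ≤ LinearMap.ker a := by
    rw [← hV.iSup_vPart]
    exact iSup_le fun m v hv => ha m v hv
  exact LinearMap.ext fun v => this Submodule.mem_top

/-- An operator that raises degrees by `k` comes from a series divisible by `X ^ k`. -/
theorem Realization.IsStandardGraded.mem_vanishBelow (hV : R.IsStandardGraded V f)
    {a : R.homSeries V f} {k : ℕ}
    (ha : ∀ m : ℤ, ∀ v : R.completion V f, (∀ n < m, v.1 n = 0) →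
      ∀ n < m + k, (R.opSeries V f a v).1 n = 0) : a.1 ∈ vanishBelow _ k := by
  intro d hd
  refine hV.end_eq_zero R fun m v hv => ?_
  rw [← R.opSeries_single V f a ⟨v, hv⟩ d]
  exact ha m _ (R.single_vanish V f ⟨v, hv⟩) _ (by omega)

theorem Realization.IsStandardGraded.opSeries_injective (hV : R.IsStandardGraded V f) :
    Function.Injective (R.opSeries V f) := by
  intro a b hab
  apply Subtype.ext
  ext1 d
  rw [← sub_eq_zero, ← map_sub]
  refine hV.end_eq_zero R fun m v hv => ?_
  rw [map_sub, LinearMap.sub_apply, ← R.opSeries_single V f a ⟨v, hv⟩ d,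
    ← R.opSeries_single V f b ⟨v, hv⟩ d, hab, sub_self]

variable (V f)

/-- The action of the group of series on the completion. -/
def Realization.actHom : expGroup (R.isGradedLie_opPart V f) →*
    LinearMap.GeneralLinearGroup ℂ (R.completion V f) :=
  MonoidHom.toHomUnits
    { toFun := fun g => R.opSeries V f ⟨_, R.mem_homSeries_of_expGroup V f g⟩
      map_one' := R.opSeries_one V f
      map_mul' := fun g h => R.opSeries_mul V f ⟨_, R.mem_homSeries_of_expGroup V f g⟩
        ⟨_, R.mem_homSeries_of_expGroup V f h⟩ }

theorem Realization.actHom_val (g : expGroup (R.isGradedLie_opPart V f)) :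
    (R.actHom V f g).1 = R.opSeries V f ⟨_, R.mem_homSeries_of_expGroup V f g⟩ := rfl

theorem Realization.actHom_sub_one (g : expGroup (R.isGradedLie_opPart V f)) :
    (R.actHom V f g).1 - 1 =
      R.opSeries V f (⟨_, R.mem_homSeries_of_expGroup V f g⟩ - 1) := by
  rw [R.opSeries_sub, R.opSeries_one, R.actHom_val]

theorem Realization.actHom_sub_one_vanish {g : expGroup (R.isGradedLie_opPart V f)} {k : ℕ}
    (hg : (g : (Module.End ℂ V)⟦X⟧ˣ) ∈ congrOne _ k) {v : R.completion V f} {N : ℤ}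
    (hN : ∀ m < N, v.1 m = 0) : ∀ m < N + k, (((R.actHom V f g).1 - 1) v).1 m = 0 := by
  rw [R.actHom_sub_one]
  exact R.opSeries_vanish V f _ hg hN

theorem Realization.mem_congrOne_one (g : expGroup (R.isGradedLie_opPart V f)) :
    (g : (Module.End ℂ V)⟦X⟧ˣ) ∈ congrOne _ 1 := by
  intro d hd
  rw [Nat.lt_one_iff.1 hd, map_sub, g.2.1, coeff_zero_one, sub_self]

/-! ### Exponentials and their products as actions of series -/

theorem Realization.rhoHat_pow_apply {k : ℤ} (x : R.gPart f k) (v : R.completion V f) (n : ℕ)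
    (m : ℤ) : ((R.rhoHat V f x ^ n) v).1 m =
      (R.actLinear V x.1 ^ n) (v.1 (m - n * k)) := by
  induction n generalizing m with
  | zero => simp
  | succ n ih =>
    rw [pow_succ', pow_succ']
    change ⁅x.1, ((R.rhoHat V f x ^ n) v).1 (m - k)⁆ = ⁅x.1, _⁆
    have h : m - k - n * k = m - (n + 1 : ℕ) * k := by
      push_cast
      ring
    rw [ih, h]

/-- The series `exp (a X ^ k)` is supported in degrees `n * k`, and reindexing the sum by `n` gives
the exponential series of `ρ(x)`. -/
theorem Realization.expRho_apply (k : ℕ+) (x : R.gPart f (k : ℤ)) (v : R.completion V f)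
    (m : ℤ) : (R.expRho V f k x v).1 m =
      ∑ᶠ i : ℕ, coeff i (expMono (k : ℕ) (R.actLinear V x.1)) (v.1 (m - i)) := by
  set a := R.actLinear V x.1 with ha
  have hinj : Function.Injective fun n : ℕ => n * (k : ℕ) :=
    fun _ _ h => Nat.eq_of_mul_eq_mul_right k.pos h
  have h1 : ∑ᶠ i : ℕ, coeff i (expMono (k : ℕ) a) (v.1 (m - i)) =
      ∑ᶠ i ∈ Set.range fun n : ℕ => n * (k : ℕ),
        coeff i (expMono (k : ℕ) a) (v.1 (m - i)) := by
    refine finsum_congr fun i => ?_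
    by_cases hi : i ∈ Set.range fun n : ℕ => n * (k : ℕ)
    · simp only [hi, finsum_true]
    · simp only [hi, finsum_false]
      rw [expMono, coeff_mk, if_neg, LinearMap.zero_apply]
      rintro ⟨n, rfl⟩
      exact hi ⟨n, mul_comm _ _⟩
  rw [h1, finsum_mem_range hinj]
  refine finsum_congr fun n => ?_
  rw [coeff_mul_expMono k.pos, R.rhoHat_pow_apply]
  push_cast
  rfl

theorem Realization.expRho_eq_opSeries (k : ℕ+) (x : R.gPart f (k : ℤ)) {a : Module.End ℂ V}
    (ha : a = R.actLinear V x.1) (h : expMono (k : ℕ) a ∈ R.homSeries V f) :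
    R.expRho V f k x = R.opSeries V f ⟨_, h⟩ := by
  subst ha
  exact LinearMap.ext fun v => Subtype.ext (funext fun m => R.expRho_apply V f k x v m)

theorem Realization.partialProd_eq (x : ∀ k : ℕ+, R.gPart f (k : ℤ))
    {a : ℕ → Module.End ℂ V} (ha : ∀ k : ℕ+, a k = R.actLinear V (x k).1)
    (n : ℕ+) (K : ℕ) (h : (expPartialProd a n K : (Module.End ℂ V)⟦X⟧) ∈ R.homSeries V f) :
    R.partialProd V f x n K = R.opSeries V f ⟨_, h⟩ := by
  have haL : ∀ k, (n : ℕ) ≤ k → a k ∈ R.opPart V f k := by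
    intro k hk
    have hk0 : 0 < k := lt_of_lt_of_le n.pos hk
    exact (R.mem_opPart V f hk0).2 ⟨_, (x ⟨k, hk0⟩).2, (ha ⟨k, hk0⟩).symm⟩
  induction K with
  | zero => exact (R.opSeries_one V f).symm
  | succ K ih =>
    have hL := R.isGradedLie_opPart V f
    have h1 := R.mem_homSeries_of_expGroup V f
      ⟨_, (expPartialProd_mem hL n.pos haL K).1⟩
    have h2 := R.mem_homSeries_of_expGroup V f
      ⟨_, expUnit_mem_expGroup hL (Nat.add_pos_left n.pos K) (haL (n + K) (Nat.le_add_right _ _))⟩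
    have h3 : R.opSeries V f ⟨_, h⟩ = R.opSeries V f ⟨_, h2⟩ * R.opSeries V f ⟨_, h1⟩ :=
      R.opSeries_mul V f ⟨_, h2⟩ ⟨_, h1⟩
    rw [h3, partialProd, ← ih h1]
    congr 1
    exact R.expRho_eq_opSeries V f ⟨n + K, _⟩ _ (ha _) h2

/-! ### The product sets as images of the congruence filtration -/

/-- The subgroup of the general linear group of the completion that corresponds to the series
congruent to `1` modulo `X ^ k`. -/
def Realization.uGroup (k : ℕ+) : Subgroup (LinearMap.GeneralLinearGroup ℂ (R.completion V f)) :=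
  ((congrOne (Module.End ℂ V) k).subgroupOf (expGroup (R.isGradedLie_opPart V f))).map
    (R.actHom V f)

theorem Realization.mem_uGroup {k : ℕ+}
    {φ : LinearMap.GeneralLinearGroup ℂ (R.completion V f)} :
    φ ∈ R.uGroup V f k ↔ ∃ g : expGroup (R.isGradedLie_opPart V f),
      (g : (Module.End ℂ V)⟦X⟧ˣ) ∈ congrOne _ k ∧ R.actHom V f g = φ := Iff.rfl

/-- For a fixed vector and degree only finitely many coefficients of a series matter, so `X`-adic
approximation by partial products of exponentials is the same as their components being eventually
constant. The two inclusions are then the factorization of a series and the existence of infinite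
products. -/
theorem Realization.coe_uGroup (n : ℕ+) :
    (R.uGroup V f n : Set (LinearMap.GeneralLinearGroup ℂ (R.completion V f))) =
      R.uHat V f n := by
  have hL := R.isGradedLie_opPart V f
  ext φ
  constructor
  · rintro ⟨g, hg, rfl⟩
    obtain ⟨a, haL, haK⟩ := exists_expPartialProd_eq n.pos g.2 hg
    -- The product starts at `n`, so the choice below `n` is free and is taken to be `0`.
    have hx : ∀ k : ℕ+, ∃ x : R.gPart f (k : ℤ), (n : ℕ) ≤ k →
        R.actLinear V x.1 = a k := by
      intro k
      by_cases hk : (n : ℕ) ≤ k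
      · obtain ⟨x, hx, hxa⟩ := (R.mem_opPart V f k.pos).1 (haL k hk)
        exact ⟨⟨x, hx⟩, fun _ => hxa⟩
      · exact ⟨0, fun h => absurd h hk⟩
    choose x hx using hx
    -- A sequence indexed by all naturals that matches `x` on positive ones; the value in degree `0`
    -- is never used.
    set b : ℕ → Module.End ℂ V := fun k =>
      if h : 0 < k then R.actLinear V (x ⟨k, h⟩).1 else 0 with hb
    have hbx : ∀ k : ℕ+, b k = R.actLinear V (x k).1 := fun k => dif_pos k.pos
    have hab : ∀ K, expPartialProd b n K = expPartialProd a n K := by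
      intro K
      induction K with
      | zero => rfl
      | succ K ih =>
        have := hbx ⟨n + K, Nat.add_pos_left n.pos K⟩
        rw [expPartialProd, expPartialProd, ih]
        congr 2
        exact this.trans (hx ⟨n + K, Nat.add_pos_left n.pos K⟩ (Nat.le_add_right _ _))
    refine ⟨x, fun v m => ?_⟩
    obtain ⟨-, N, hN⟩ := v.2
    filter_upwards [Filter.eventually_ge_atTop (m - N).toNat] with K hK
    have hmem := R.mem_homSeries_of_expGroup V f
      ⟨_, (expPartialProd_mem hL n.pos haL K).1⟩
    rw [R.partialProd_eq V f x hbx n K (by rw [hab]; exact hmem), R.actHom_val]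
    refine R.opSeries_congr V f hN (K := n + K) (by have := n.pos; push_cast; omega) fun d hd => ?_
    rw [haK K d hd]
    simp only [hab]
  · rintro ⟨x, hx⟩
    set a : ℕ → Module.End ℂ V := fun k =>
      if h : 0 < k then R.actLinear V (x ⟨k, h⟩).1 else 0 with ha
    have hax : ∀ k : ℕ+, a k = R.actLinear V (x k).1 := fun k => dif_pos k.pos
    have haL : ∀ k, (n : ℕ) ≤ k → a k ∈ R.opPart V f k := by
      intro k hk
      have hk0 : 0 < k := lt_of_lt_of_le n.pos hk
      exact (R.mem_opPart V f hk0).2 ⟨_, (x ⟨k, hk0⟩).2, (hax ⟨k, hk0⟩).symm⟩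
    obtain ⟨g, hg, hgn, hgK⟩ := exists_expProd hL n.pos haL
    refine ⟨⟨g, hg⟩, hgn, Units.ext (LinearMap.ext fun v => Subtype.ext (funext fun m => ?_))⟩
    obtain ⟨-, N, hN⟩ := v.2
    -- One stage `K` at which the partial product has reached its limit and all coefficients
    -- relevant in degree `m` are stable.
    obtain ⟨K, hK, hK'⟩ := ((hx v m).and (Filter.eventually_ge_atTop (m - N).toNat)).exists
    have hmem := R.mem_homSeries_of_expGroup V f
      ⟨_, (expPartialProd_mem hL n.pos haL K).1⟩
    rw [← hK, R.partialProd_eq V f x hax n K hmem, R.actHom_val]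
    exact R.opSeries_congr V f hN (K := n + K) (by have := n.pos; push_cast; omega)
      fun d hd => hgK K d hd

theorem Realization.uGroup_antitone : Antitone (R.uGroup V f) := by
  rintro j k hjk _ ⟨g, hg, rfl⟩
  exact ⟨g, congrOne_antitone ((PNat.coe_le_coe j k).2 hjk) hg, rfl⟩

variable {V f}

theorem Realization.IsStandardGraded.actHom_injective (hV : R.IsStandardGraded V f) :
    Function.Injective (R.actHom V f) := by
  intro g h hgh
  have := hV.opSeries_injective R (congrArg Units.val hgh)
  exact Subtype.ext (Units.ext (congrArg Subtype.val this))

/-- The largest group of the filtration is isomorphic to the group of series. -/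
def Realization.IsStandardGraded.uEquiv (hV : R.IsStandardGraded V f) :
    R.uGroup V f 1 ≃* expGroup (R.isGradedLie_opPart V f) :=
  ((MonoidHom.ofInjective (hV.actHom_injective R)).trans (MulEquiv.subgroupCongr (by
    ext φ
    rw [R.mem_uGroup, MonoidHom.mem_range]
    exact ⟨fun ⟨g, h⟩ => ⟨g, R.mem_congrOne_one V f g, h⟩, fun ⟨g, _, h⟩ => ⟨g, h⟩⟩))).symm

theorem Realization.IsStandardGraded.actHom_uEquiv (hV : R.IsStandardGraded V f)
    (γ : R.uGroup V f 1) : R.actHom V f (hV.uEquiv R γ) = γ := by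
  obtain ⟨g, rfl⟩ := (hV.uEquiv R).symm.surjective γ
  rw [MulEquiv.apply_symm_apply]
  rfl

theorem Realization.IsStandardGraded.mem_uGroup_iff (hV : R.IsStandardGraded V f) (k : ℕ+)
    (γ : R.uGroup V f 1) : γ ∈ (R.uGroup V f k).subgroupOf (R.uGroup V f 1) ↔
      (hV.uEquiv R γ : (Module.End ℂ V)⟦X⟧ˣ) ∈ congrOne _ (k : ℕ) := by
  rw [Subgroup.mem_subgroupOf, R.mem_uGroup]
  constructor
  · rintro ⟨g, hg, h⟩
    rw [← hV.actHom_uEquiv R γ] at h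
    rwa [← hV.actHom_injective R h]
  · exact fun h => ⟨_, h, hV.actHom_uEquiv R γ⟩

theorem Realization.IsStandardGraded.normal_uGroup (hV : R.IsStandardGraded V f) (k : ℕ+) :
    ((R.uGroup V f k).subgroupOf (R.uGroup V f 1)).Normal where
  conj_mem γ hγ δ := by
    rw [hV.mem_uGroup_iff] at hγ ⊢
    rw [map_mul, map_mul, map_inv]
    exact (congrOne_normal (k : ℕ)).conj_mem _ hγ _

theorem Realization.uGroup_sub_one_vanish {γ : LinearMap.GeneralLinearGroup ℂ (R.completion V f)}
    {k : ℕ+} (hγ : γ ∈ R.uGroup V f k) {v : R.completion V f} {j : ℤ} (hv : v ∈ R.nHat V f j) :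
    (γ.1 - 1) v ∈ R.nHat V f (j + (k : ℤ)) := by
  obtain ⟨g, hg, rfl⟩ := hγ
  exact R.actHom_sub_one_vanish V f hg hv

theorem Realization.nHat_antitone : Antitone (R.nHat V f) :=
  fun _ _ h _ hv m hm => hv m (lt_of_lt_of_le hm h)

theorem Realization.uGroup_apply_mem {γ : LinearMap.GeneralLinearGroup ℂ (R.completion V f)}
    (hγ : γ ∈ R.uGroup V f 1) {v : R.completion V f} {j : ℤ} (hv : v ∈ R.nHat V f j) :
    γ.1 v ∈ R.nHat V f j := by
  have h1 := R.nHat_antitone (by omega : j ≤ j + ((1 : ℕ+) : ℕ)) (R.uGroup_sub_one_vanish hγ hv)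
  have h2 := add_mem h1 hv
  rwa [LinearMap.sub_apply, Module.End.one_apply, sub_add_cancel] at h2

/-- Surjectivity needs the inverse, which belongs to the group and therefore preserves the same
subspace. -/
theorem Realization.map_nHat {γ : LinearMap.GeneralLinearGroup ℂ (R.completion V f)}
    (hγ : γ ∈ R.uGroup V f 1) (j : ℤ) : (R.nHat V f j).map γ.1 = R.nHat V f j := by
  refine le_antisymm ?_ fun v hv => ⟨(γ⁻¹).1 v, R.uGroup_apply_mem (inv_mem hγ) hv, ?_⟩
  · rintro _ ⟨v, hv, rfl⟩
    exact R.uGroup_apply_mem hγ hv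
  · exact LinearMap.congr_fun (Units.mul_inv γ) v

theorem Realization.sub_one_pow_mem {γ : LinearMap.GeneralLinearGroup ℂ (R.completion V f)}
    (hγ : γ ∈ R.uGroup V f 1) {v : R.completion V f} {j : ℤ} (hv : v ∈ R.nHat V f j) (r : ℕ) :
    ((γ.1 - 1) ^ r) v ∈ R.nHat V f (j + r) := by
  induction r with
  | zero => simpa using hv
  | succ r ih =>
    rw [pow_succ']
    have := R.uGroup_sub_one_vanish hγ ih
    rwa [PNat.one_coe, add_assoc] at this

theorem Realization.exists_sub_one_pow_mem
    {γ : LinearMap.GeneralLinearGroup ℂ (R.completion V f)}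
    (hγ : γ ∈ R.uGroup V f 1) (j : ℤ) (v : R.completion V f) :
    ∃ r : ℕ, ((γ.1 - 1) ^ r) v ∈ R.nHat V f j := by
  obtain ⟨-, N, hN⟩ := v.2
  -- A vector starting in degree `N` is moved up by at least one degree at each application of `γ -
  -- 1`.
  exact ⟨(j - N).toNat, R.nHat_antitone (by omega) (R.sub_one_pow_mem hγ (j := N) hN _)⟩

/-! ### The action on the subquotients -/

variable (V f) in
/-- The product of the subquotients `N̂_j / N̂_{j+k}`. -/
abbrev Realization.subquotients (k : ℕ+) :=
  ∀ j : ℤ, R.nHat V f j ⧸ (R.nHat V f (j + (k : ℤ))).comap (R.nHat V f j).subtype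

variable (V f) in
/-- The action of the group on the product of the subquotients. -/
def Realization.subquotientHom (k : ℕ+) :
    R.uGroup V f 1 →* Module.End ℂ (R.subquotients V f k) where
  toFun γ := LinearMap.pi fun j =>
    Submodule.mapQ _ _ (γ.1.1.restrict fun _ hv => R.uGroup_apply_mem γ.2 hv)
      (fun _ hv => R.uGroup_apply_mem γ.2 hv) ∘ₗ LinearMap.proj j
  map_one' := by
    refine LinearMap.ext fun v => funext fun j => ?_
    obtain ⟨w, hw⟩ := Submodule.Quotient.mk_surjective _ (v j)
    rw [LinearMap.pi_apply, LinearMap.comp_apply, LinearMap.proj_apply, ← hw]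
    exact hw
  map_mul' γ δ := by
    refine LinearMap.ext fun v => funext fun j => ?_
    obtain ⟨w, hw⟩ := Submodule.Quotient.mk_surjective _ (v j)
    rw [Module.End.mul_apply]
    simp only [LinearMap.pi_apply, LinearMap.comp_apply, LinearMap.proj_apply, ← hw]
    rfl

theorem Realization.subquotientHom_apply (k : ℕ+) (γ : R.uGroup V f 1) {v w : ∀ j : ℤ, R.nHat V f j}
    (hw : ∀ j, (w j : R.completion V f) = γ.1.1 (v j)) :
    R.subquotientHom V f k γ (fun j => Submodule.Quotient.mk (v j)) =
      fun j => Submodule.Quotient.mk (w j) := by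
  funext j
  have : w j = γ.1.1.restrict (fun _ hv => R.uGroup_apply_mem γ.2 hv) (v j) := Subtype.ext (hw j)
  rw [this]
  rfl

/-- Acting trivially on all `N̂_j / N̂_{j+k}` means that `γ - 1` raises degrees by at least `k`.
Testing on homogeneous vectors, this is divisibility of its series by `X ^ k`. -/
theorem Realization.IsStandardGraded.subquotientHom_eq_one_iff (hV : R.IsStandardGraded V f)
    (k : ℕ+) (γ : R.uGroup V f 1) :
    R.subquotientHom V f k γ = 1 ↔ γ ∈ (R.uGroup V f k).subgroupOf (R.uGroup V f 1) := by
  have key : ∀ v : ∀ j : ℤ, R.nHat V f j,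
      R.subquotientHom V f k γ (fun j => Submodule.Quotient.mk (v j)) =
        (fun j => Submodule.Quotient.mk (v j)) ↔
      ∀ j, (γ.1.1 - 1) (v j : R.completion V f) ∈ R.nHat V f (j + (k : ℤ)) := by
    intro v
    rw [R.subquotientHom_apply k γ
      (w := fun j => ⟨γ.1.1 (v j), R.uGroup_apply_mem γ.2 (v j).2⟩) fun _ => rfl, funext_iff]
    exact forall_congr' fun j => Submodule.Quotient.eq _
  constructor
  · intro h
    rw [hV.mem_uGroup_iff]
    refine hV.mem_vanishBelow R (a := ⟨_, R.mem_homSeries_of_expGroup V f (hV.uEquiv R γ)⟩ - 1)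
      fun m v hv => ?_
    rw [← R.actHom_sub_one, hV.actHom_uEquiv]
    have h1 := (key fun j => if h : m ≤ j then 0 else ⟨v, R.nHat_antitone (not_le.1 h).le hv⟩).1
      (by rw [h]; rfl)
    -- The vector is placed in the single factor `j = m` of the product.
    have h2 := (key (Pi.single m ⟨v, hv⟩)).1 (by rw [h]; rfl) m
    rw [Pi.single_eq_same] at h2
    exact h2
  · intro h
    refine LinearMap.ext fun v => ?_
    choose w hw using fun j => Submodule.Quotient.mk_surjective _ (v j)
    obtain rfl : (fun j => Submodule.Quotient.mk (w j)) = v := funext hw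
    exact (key w).2 fun j => R.uGroup_sub_one_vanish h (w j).2

theorem Realization.subquotientHom_sub_one_pow (k : ℕ+) (γ : R.uGroup V f 1) :
    (R.subquotientHom V f k γ - 1) ^ (k : ℕ) = 0 := by
  have key : ∀ (r : ℕ) (v : ∀ j : ℤ, R.nHat V f j), ∃ w : ∀ j : ℤ, R.nHat V f j,
      (∀ j, (w j : R.completion V f) = ((γ.1.1 - 1) ^ r) (v j)) ∧
      ((R.subquotientHom V f k γ - 1) ^ r) (fun j => Submodule.Quotient.mk (v j)) =
        fun j => Submodule.Quotient.mk (w j) := by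
    intro r v
    induction r with
    | zero => exact ⟨v, fun _ => rfl, rfl⟩
    | succ r ih =>
      obtain ⟨w, hw, hw'⟩ := ih
      refine ⟨fun j => ⟨γ.1.1 (w j), R.uGroup_apply_mem γ.2 (w j).2⟩ - w j, fun j => ?_, ?_⟩
      · rw [pow_succ', Module.End.mul_apply, ← hw]
        rfl
      · rw [pow_succ', Module.End.mul_apply, hw', LinearMap.sub_apply,
          R.subquotientHom_apply k γ
            (w := fun j => ⟨γ.1.1 (w j), R.uGroup_apply_mem γ.2 (w j).2⟩) fun _ => rfl]
        rfl
  refine LinearMap.ext fun v => ?_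
  choose v' hv' using fun j => Submodule.Quotient.mk_surjective _ (v j)
  obtain rfl : (fun j => Submodule.Quotient.mk (v' j)) = v := funext hv'
  obtain ⟨w, hw, h⟩ := key k v'
  rw [h]
  funext j
  refine (Submodule.Quotient.mk_eq_zero _).2 ?_
  change (w j : R.completion V f) ∈ R.nHat V f (j + (k : ℤ))
  rw [hw]
  exact R.sub_one_pow_mem γ.2 (v' j).2 k

end Action

end KacMoody

end

/-! ### The theorem -/

theorem mainTheorem4 {l : ℕ} (A : Matrix (Fin l) (Fin l) ℤ) (hA : KacMoody.IsGCM A)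
    (hsymm : KacMoody.IsSymmetrizable A)
    {𝔥 : Type*} [AddCommGroup 𝔥] [Module ℂ 𝔥] (R : KacMoody.Realization A 𝔥)
    (P : AddSubgroup (Module.Dual ℂ 𝔥)) (hP : R.IsRestrictedWeightLattice P)
    (V : Type*) [AddCommGroup V] [Module ℂ V]
    [LieRingModule R.LieAlg V] [LieModule ℂ R.LieAlg V]
    (f : P →+ ℤ) (hV : R.IsStandardGraded V f) :
    -- the sets `Û⁺_{V,k}` are a descending chain of subgroups, normal in `Û⁺_{V,1}`
    ∃ U : ℕ+ → Subgroup (LinearMap.GeneralLinearGroup ℂ (R.completion V f)),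
      (∀ k, (U k : Set (LinearMap.GeneralLinearGroup ℂ (R.completion V f))) = R.uHat V f k) ∧
      Antitone U ∧
    ∃ (_ : ∀ k, ((U k).subgroupOf (U 1)).Normal)
      (hanti : Antitone fun k : ℕ+ => (U k).subgroupOf (U 1)),
      -- `Û⁺_{V,1}` is pro-unipotent, and is the inverse limit of the quotients
      -- `Û⁺_{V,1}/Û⁺_{V,k}`, which are unipotent algebraic groups
      KacMoody.IsProUnipotent (U 1) ∧
      Function.Bijective
        (KacMoody.toInverseLimit (fun k : ℕ+ => (U k).subgroupOf (U 1)) hanti) ∧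
      KacMoody.IsUnipotentSystem (fun k : ℕ+ => (U k).subgroupOf (U 1)) hanti ∧
      -- `Û⁺_{V,1}` preserves each `N̂_j` and acts by locally unipotent maps on `V̂/N̂_j`
      (∀ g ∈ U 1, ∀ j : ℤ, (R.nHat V f j).map g.1 = R.nHat V f j) ∧
      (∀ g ∈ U 1, ∀ (j : ℤ) (v : R.completion V f),
        ∃ r : ℕ, ((g.1 - 1) ^ r) v ∈ R.nHat V f j) ∧
      -- `Û⁺_{V,1}/Û⁺_{V,k}` acts faithfully and unipotently on the product over `j` of the
      -- subquotients `N̂_j/N̂_{j+k}`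
      ∀ k : ℕ+, ∃ σ : Representation ℂ (U 1 ⧸ (U k).subgroupOf (U 1))
          (∀ j : ℤ, R.nHat V f j ⧸
            (R.nHat V f (j + (k : ℤ))).comap (R.nHat V f j).subtype),
        (∀ (g : U 1) (v w : ∀ j : ℤ, R.nHat V f j),
          (∀ j, (w j : R.completion V f) = g.1.1 (v j)) →
          σ (QuotientGroup.mk g) (fun j => Submodule.Quotient.mk (v j)) =
            fun j => Submodule.Quotient.mk (w j)) ∧
        Function.Injective σ ∧
        ∀ q, (σ q - 1) ^ (k : ℕ) = 0 := by

  have hnormal := fun k => hV.normal_uGroup R k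
  have hanti : Antitone fun k : ℕ+ => (R.uGroup V f k).subgroupOf (R.uGroup V f 1) :=
    fun j k hjk γ hγ => R.uGroup_antitone V f hjk hγ
  have hbij := KacMoody.bijective_toInverseLimit (hV.uEquiv R) hanti fun k γ =>
    hV.mem_uGroup_iff R k γ
  have hsys := KacMoody.isUnipotentSystem (hV.uEquiv R) (fun d => hV.finite_opPart R d) hanti
    fun k γ => hV.mem_uGroup_iff R k γ
  refine ⟨R.uGroup V f, R.coe_uGroup V f, R.uGroup_antitone V f, hnormal, hanti,
    ⟨ℕ+, inferInstance, inferInstance, inferInstance, _, hnormal, hanti, hsys, hbij⟩, hbij, hsys,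
    fun g hg j => R.map_nHat hg j, fun g hg j v => R.exists_sub_one_pow_mem hg j v, fun k => ?_⟩
  -- The kernel on the subquotients is exactly the `k`-th subgroup; one inclusion makes the action
  -- descend to the quotient, the other makes it faithful.
  refine ⟨QuotientGroup.lift _ (R.subquotientHom V f k) fun γ hγ =>
    (hV.subquotientHom_eq_one_iff R k γ).2 hγ, ?_, ?_, ?_⟩
  · exact fun g v w hw => R.subquotientHom_apply k g hw
  · rw [injective_iff_map_eq_one]
    intro q hq
    obtain ⟨γ, rfl⟩ := QuotientGroup.mk_surjective q
    exact (QuotientGroup.eq_one_iff γ).2 ((hV.subquotientHom_eq_one_iff R k γ).1 hq)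
  · intro q
    obtain ⟨γ, rfl⟩ := QuotientGroup.mk_surjective q
    exact R.subquotientHom_sub_one_pow k γ
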